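/- Let $T>0$ and $\lambda>0$. Let $(\Omega,\mathcal F,(\mathcal F_t)_{t\ge 0},\mathbb P)$ be a filtered probability space, let $W=(W(t))_{t\ge0}$ be a standard Wiener process with respect to $(\mathcal F_t)_{t\ge0}$, and let $N=(N(t))_{t\ge0}$ be a homogeneous Poisson process with intensity $\lambda$ with respect to $(\mathcal F_t)_{t\ge0}$. (Thus both processes are adapted, start at $0$, and have increments after time $s$ that are independent of $\mathcal F_s$.) Consider the jump-diffusion Lévy area, i.e. the Itô integral $$J(N,W)=\int_0^T N(t)\,dW(t).$$ For $n\ge 1$ let $\Phi_n$ be the class of all methods of the form $$\mathcal A_n(N,W)=\varphi_n(\mathcal N_n(N,W)),\qquad \mathcal N_n(N,W)=\big(N(t_1),\dots,N(t_n),W(t_1),\dots,W(t_n)\big),$$ where $0=t_0<t_1<\dots<t_n=T$ is an arbitrary fixed (deterministic) discretization of $[0,T]$ and $\varphi_n\colon\mathbb R^{2n}\to\mathbb R$ is Borel measurable. The trapezoidal method based on the mesh $0=t_0<t_1<\dots<t_n=T$ is $$\mathcal A_n^T(N,W)=\sum_{i=0}^{n-1}\tfrac12\big(W(t_{i+1})-W(t_i)\big)\big(N(t_{i+1})+N(t_i)\big).$$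 Write $\|X\|_2=(\mathbb E|X|^2)^{1/2}$, with the value $\infty$ if $X$ is not square integrable. Then $J(N,W)$ exists, and the following hold. 1. For every $n\ge1$ and every mesh $0=t_0<t_1<\dots<t_n=T$ (in particular the equidistant one), almost surely $$\mathcal A_n^T(N,W)=\mathbb E\big[J(N,W)\,\big|\,\mathcal N_n(N,W)\big].$$ 2. For the trapezoidal method $\mathcal A_n^T$ based on the equidistant mesh $t_i=iT/n$, $i=0,\dots,n$, $$\lim_{n\to\infty}n^{1/2}\,\big\|J(N,W)-\mathcal A_n^T(N,W)\big\|_2=\lim_{n\to\infty}n^{1/2}\inf_{\mathcal A_n\in\Phi_n}\big\|J(N,W)-\mathcal A_n(N,W)\big\|_2=\frac{\lambda^{1/2}T}{2}.$$ 3. The trapezoidal method $\mathcal A_n^T$ based on the equidistant mesh is optimal in $\Phi_n$: for every $n\ge1$, $$\big\|J(N,W)-\mathcal A_n^T(N,W)\big\|_2=\inf_{\mathcal A_n\in\Phi_n}\big\|J(N,W)-\mathcal A_n(N,W)\big\|_2.$$ -/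

import Mathlib

open MeasureTheory ProbabilityTheory Filter Topology
open scoped NNReal ENNReal

namespace LevyArea

variable {Ω : Type*} {mΩ : MeasurableSpace Ω}

/-- A standard one-dimensional Wiener process with respect to the filtration `𝓕`: a Brownian motion
(started at `0`, with almost surely continuous paths) that is adapted to `𝓕` and whose increments
after time `s` are independent of `𝓕 s`. -/
structure IsWiener (𝓕 : Filtration ℝ≥0 mΩ) (P : Measure Ω) (W : ℝ≥0 → Ω → ℝ) : Prop where
  isBrownian : IsBrownianReal W P
  adapted : Adapted 𝓕 W
  indep_increment : ∀ s t : ℝ≥0, s ≤ t →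
    Indep (𝓕 s) (MeasurableSpace.comap (fun ω ↦ W t ω - W s ω) inferInstance) P

/-- A homogeneous Poisson process of intensity `lam` with respect to the filtration `𝓕`: it is
adapted to `𝓕`, starts at `0`, its increments over `(s, t]` are independent of `𝓕 s` and
Poisson distributed with mean `lam * (t - s)`, and almost all its paths are right-continuous with
left limits. -/
structure IsPoisson (𝓕 : Filtration ℝ≥0 mΩ) (P : Measure Ω) (lam : ℝ≥0) (N : ℝ≥0 → Ω → ℝ) :
    Prop where
  adapted : Adapted 𝓕 N
  zero : ∀ᵐ ω ∂P, N 0 ω = 0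
  indep_increment : ∀ s t : ℝ≥0, s ≤ t →
    Indep (𝓕 s) (MeasurableSpace.comap (fun ω ↦ N t ω - N s ω) inferInstance) P
  law_increment : ∀ s t : ℝ≥0, s ≤ t →
    HasLaw (fun ω ↦ N t ω - N s ω)
      ((poissonMeasure (lam * (t - s))).map (Nat.cast : ℕ → ℝ)) P
  cadlag : ∀ᵐ ω ∂P, ∀ t : ℝ≥0,
    ContinuousWithinAt (fun r ↦ N r ω) (Set.Ici t) t ∧
      ∃ l : ℝ, Tendsto (fun r ↦ N r ω) (𝓝[<] t) (𝓝 l)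

/-- A simple (elementary predictable) process: on each of the finitely many intervals
`(τ i, τ (i + 1)]`, `i < k`, it equals a bounded `𝓕 (τ i)`-measurable random variable `ξ i`, and it
vanishes elsewhere. -/
structure SimpleProcess (𝓕 : Filtration ℝ≥0 mΩ) where
  k : ℕ
  τ : ℕ → ℝ≥0
  monotone_τ : Monotone τ
  ξ : ℕ → Ω → ℝ
  measurable_ξ : ∀ i, Measurable[𝓕 (τ i)] (ξ i)
  bounded_ξ : ∃ C : ℝ, ∀ i ω, |ξ i ω| ≤ C

namespace SimpleProcess

variable {𝓕 : Filtration ℝ≥0 mΩ}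

/-- The value of a simple process at time `t`. -/
noncomputable def val (φ : SimpleProcess 𝓕) (t : ℝ≥0) (ω : Ω) : ℝ :=
  ∑ i ∈ Finset.range φ.k, (Set.Ioc (φ.τ i) (φ.τ (i + 1))).indicator (fun _ ↦ φ.ξ i ω) t

/-- The elementary stochastic integral `∫_0^T φ(t) dW(t)` of a simple process. -/
noncomputable def integral (φ : SimpleProcess 𝓕) (W : ℝ≥0 → Ω → ℝ) (T : ℝ≥0) (ω : Ω) : ℝ :=
  ∑ i ∈ Finset.range φ.k, φ.ξ i ω * (W (min (φ.τ (i + 1)) T) ω - W (min (φ.τ i) T) ω)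

end SimpleProcess

/-- `J` is (a version of) the Itô integral `∫_0^T f(t) dW(t)`: `f` is square integrable on
`(0, T] × Ω`, and there are simple processes converging to `f` in `L²((0, T] × Ω)` whose elementary
stochastic integrals converge to `J` in `L²(Ω)`. Here `(0, T] × Ω` carries the product of the
Lebesgue measure (on the real line, times being cast by `Real.toNNReal`) with `P`. -/
def IsItoIntegral (𝓕 : Filtration ℝ≥0 mΩ) (P : Measure Ω) (W : ℝ≥0 → Ω → ℝ) (T : ℝ≥0)
    (f : ℝ≥0 → Ω → ℝ) (J : Ω → ℝ) : Prop :=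
  MemLp (fun p : ℝ × Ω ↦ f p.1.toNNReal p.2) 2
    (((volume : Measure ℝ).restrict (Set.Ioc 0 (T : ℝ))).prod P) ∧
  MemLp J 2 P ∧
  ∃ φ : ℕ → SimpleProcess 𝓕,
    Tendsto (fun m ↦ eLpNorm
      (fun p : ℝ × Ω ↦ f p.1.toNNReal p.2 - (φ m).val p.1.toNNReal p.2) 2
      (((volume : Measure ℝ).restrict (Set.Ioc 0 (T : ℝ))).prod P)) atTop (𝓝 0) ∧
    Tendsto (fun m ↦ eLpNorm (fun ω ↦ J ω - (φ m).integral W T ω) 2 P) atTop (𝓝 0)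

/-- The nodes `0 = t_0 < t_1 < ... < t_n = T` form a discretization of `[0, T]`. -/
structure IsMesh (T : ℝ≥0) (n : ℕ) (t : Fin (n + 1) → ℝ≥0) : Prop where
  strictMono : StrictMono t
  first : t 0 = 0
  last : t (Fin.last n) = T

/-- The equidistant nodes `t_i = i T / n`, `i = 0, ..., n`. -/
noncomputable def equidistant (T : ℝ≥0) (n : ℕ) (i : Fin (n + 1)) : ℝ≥0 :=
  (i : ℝ≥0) * T / n

/-- The information `(N(t_1), ..., N(t_n), W(t_1), ..., W(t_n))`. -/
def info (N W : ℝ≥0 → Ω → ℝ) {n : ℕ} (t : Fin (n + 1) → ℝ≥0) (ω : Ω) :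
    (Fin n → ℝ) × (Fin n → ℝ) :=
  (fun i ↦ N (t i.succ) ω, fun i ↦ W (t i.succ) ω)

/-- All methods that apply a Borel function to the values of `N` and `W` at the `n` nodes
`t_1, ..., t_n` of some discretization of `[0, T]`. -/
def methods (N W : ℝ≥0 → Ω → ℝ) (T : ℝ≥0) (n : ℕ) : Set (Ω → ℝ) :=
  {A | ∃ t : Fin (n + 1) → ℝ≥0, IsMesh T n t ∧
    ∃ φ : (Fin n → ℝ) × (Fin n → ℝ) → ℝ, Measurable φ ∧ A = fun ω ↦ φ (info N W t ω)}

/-- The trapezoidal method based on the nodes `t_0, ..., t_n`. -/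
noncomputable def trapezoidal (N W : ℝ≥0 → Ω → ℝ) {n : ℕ} (t : Fin (n + 1) → ℝ≥0) (ω : Ω) : ℝ :=
  ∑ i : Fin n, 1 / 2 * (W (t i.succ) ω - W (t i.castSucc) ω) *
    (N (t i.succ) ω + N (t i.castSucc) ω)

/-- The `L²(Ω)`-error of the approximation `A` of `J`. -/
noncomputable def error (P : Measure Ω) (J A : Ω → ℝ) : ℝ≥0∞ :=
  eLpNorm (fun ω ↦ J ω - A ω) 2 P

/-- The `n`-th minimal error for the approximation of `J`. -/
noncomputable def minimalError (P : Measure Ω) (N W : ℝ≥0 → Ω → ℝ) (T : ℝ≥0) (J : Ω → ℝ)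
    (n : ℕ) : ℝ≥0∞ :=
  ⨅ A ∈ methods N W T n, error P J A

end LevyArea

/-! Given the node values, the increments of `N` and of `W` inside a mesh interval are exchangeable,
separately for the two processes. Divide each mesh interval into `k` equal parts. The Riemann sum of
the Itô integral is the left-point sum over the mesh plus, for each mesh interval, the products
(increment of `N` over part `l`) × (increment of `W` over part `j`) with `l < j`. By exchangeability
all `k²` such products have the same integral over an event determined by the node values, and
together they sum to the product of the two increments over the whole mesh interval. The `k (k - 1)
/ 2` pairs with `l < j` therefore carry the weight `(1 - 1 / k) / 2`, which tends to `1 / 2`: this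
is the trapezoidal correction. The argument is carried by `map_increments_perm`,
`setIntegral_increment_mul_increment_eq` and `setIntegral_riemannSum`.

Exchangeability rests on the joint independence of the two processes, which is not a hypothesis:
each is only assumed to have increments independent of the common past. It is proved in
`integral_mul_character_mul_character`. Over a short interval of length `h` the joint characteristic
function of the increments nearly factorises, because an increment of `N` is nonzero only with
probability of order `h` while the increment of `W` is then still small. These errors add up to
something arbitrarily small over a fine subdivision.

Since the trapezoidal method is a conditional expectation, it is the best method on its own mesh,
and its squared error is the second moment of the integral minus its own. The first comes from the
Itô isometry, the second from independence. With mesh gaps `h_i` the difference is the sum of `lam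
h_i² / 4 + lam² h_i³ / 12` (`integral_sub_trapezoidal_sq`). By convexity it is least when all gaps
equal `T / n` (`squaredError_equidistant_le`), which gives optimality among all meshes, and its
leading term `lam T² / (4 n)` gives the limit. -/

namespace LevyArea

variable {Ω : Type*} {mΩ : MeasurableSpace Ω}

/-! ### Moments of the Poisson and Gaussian distributions -/

/-- The cancellation `n / n! = 1 / (n - 1)!` trades a factor `n` for a factor `r` and an index
shift. Applied once and twice to the total mass, it gives the first two moments. -/
lemma hasSum_poisson_cast_mul {r : ℝ≥0} {f : ℕ → ℝ} {S : ℝ}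
    (h : HasSum (fun n : ℕ ↦ Real.exp (-r) * r ^ n / n.factorial * f (n + 1)) S) :
    HasSum (fun n : ℕ ↦ Real.exp (-r) * r ^ n / n.factorial * (n * f n)) (r * S) := by
  rw [← hasSum_nat_add_iff' 1]
  simp only [Finset.range_one, Finset.sum_singleton, Nat.cast_zero, zero_mul, mul_zero, sub_zero]
  refine (h.mul_left (r : ℝ)).congr_fun fun n ↦ ?_
  rw [Nat.factorial_succ]
  push_cast
  field_simp
  ring

lemma hasSum_poisson_id (r : ℝ≥0) :
    HasSum (fun n : ℕ ↦ Real.exp (-r) * r ^ n / n.factorial * (n : ℝ)) r := by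
  have h := hasSum_one_poissonMeasure r
  have h2 := hasSum_poisson_cast_mul (f := fun _ ↦ 1) (S := 1) (by simpa only [mul_one] using h)
  simpa only [mul_one] using h2

lemma hasSum_poisson_sq (r : ℝ≥0) :
    HasSum (fun n : ℕ ↦ Real.exp (-r) * r ^ n / n.factorial * (n : ℝ) ^ 2) (r + r ^ 2) := by
  have h := (hasSum_poisson_id r).add (hasSum_one_poissonMeasure r)
  have h2 := hasSum_poisson_cast_mul (f := fun n ↦ (n : ℝ)) (S := r + 1)
    (h.congr_fun fun n ↦ by push_cast; ring)
  convert h2 using 1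
  · ext n; ring
  · ring

lemma integrable_sq_poisson (r : ℝ≥0) :
    Integrable (fun x : ℝ ↦ x ^ 2) ((poissonMeasure r).map (Nat.cast : ℕ → ℝ)) := by
  rw [integrable_map_measure (by fun_prop) (by fun_prop), integrable_poissonMeasure_iff]
  simpa using (hasSum_poisson_sq r).summable

lemma integral_id_poisson (r : ℝ≥0) :
    ∫ x, x ∂((poissonMeasure r).map (Nat.cast : ℕ → ℝ)) = r := by
  rw [integral_map (by fun_prop) (by fun_prop), integral_poissonMeasure]
  simpa using (hasSum_poisson_id r).tsum_eq

lemma integral_sq_poisson (r : ℝ≥0) :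
    ∫ x, x ^ 2 ∂((poissonMeasure r).map (Nat.cast : ℕ → ℝ)) = r + r ^ 2 := by
  rw [integral_map (by fun_prop) (by fun_prop), integral_poissonMeasure]
  simpa using (hasSum_poisson_sq r).tsum_eq

/-- Scaling by `√v`. Only the order `v ^ 2` matters later, so the constant is never evaluated. -/
lemma integral_pow_four_gaussianReal (v : ℝ≥0) :
    ∫ x, x ^ 4 ∂gaussianReal 0 v = (v : ℝ) ^ 2 * ∫ x, x ^ 4 ∂gaussianReal 0 1 := by
  have h := gaussianReal_map_const_mul (μ := 0) (v := 1) (√v)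
  have h2 : (gaussianReal 0 1).map (√v * ·) = gaussianReal 0 v := by
    rw [h]
    congr 1
    · simp
    · ext; simp [Real.sq_sqrt]
  rw [← h2, integral_map (by fun_prop) (by fun_prop), ← integral_const_mul]
  congr with x
  rw [mul_pow, show √(v : ℝ) ^ 4 = (√(v : ℝ) ^ 2) ^ 2 by ring, Real.sq_sqrt v.coe_nonneg]

/-! ### Increments of the Wiener process and of the Poisson process -/

section Increments

variable {𝓕 : Filtration ℝ≥0 mΩ} {P : Measure Ω} {W N : ℝ≥0 → Ω → ℝ} {lam : ℝ≥0}

lemma IsWiener.measurable (hW : IsWiener 𝓕 P W) (t : ℝ≥0) : Measurable (W t) :=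
  (hW.adapted t).mono (𝓕.le t) le_rfl

lemma IsPoisson.measurable (hN : IsPoisson 𝓕 P lam N) (t : ℝ≥0) : Measurable (N t) :=
  (hN.adapted t).mono (𝓕.le t) le_rfl

lemma IsWiener.law_increment (hW : IsWiener 𝓕 P W) {s t : ℝ≥0} (h : s ≤ t) :
    HasLaw (fun ω ↦ W t ω - W s ω) (gaussianReal 0 (t - s)) P := by
  have e : t - s = nndist t.1 s.1 := by
    apply NNReal.coe_injective
    change _ = |(t : ℝ) - s|
    rw [NNReal.coe_sub h, abs_of_nonneg (by simpa using h)]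
  rw [e]
  exact hW.isBrownian.hasLaw_sub t s

lemma IsWiener.indepFun_increment (hW : IsWiener 𝓕 P W) {E : Type*} [MeasurableSpace E]
    {s t : ℝ≥0} (h : s ≤ t) {Z : Ω → E} (hZ : Measurable[𝓕 s] Z) :
    IndepFun Z (fun ω ↦ W t ω - W s ω) P :=
  (IndepFun_iff_Indep _ _ _).2 (indep_of_indep_of_le_left (hW.indep_increment s t h) hZ.comap_le)

lemma IsPoisson.indepFun_increment (hN : IsPoisson 𝓕 P lam N) {E : Type*} [MeasurableSpace E]
    {s t : ℝ≥0} (h : s ≤ t) {Z : Ω → E} (hZ : Measurable[𝓕 s] Z) :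
    IndepFun Z (fun ω ↦ N t ω - N s ω) P :=
  (IndepFun_iff_Indep _ _ _).2 (indep_of_indep_of_le_left (hN.indep_increment s t h) hZ.comap_le)

lemma IsWiener.memLp_increment (hW : IsWiener 𝓕 P W) {s t : ℝ≥0} (h : s ≤ t) {p : ℝ≥0∞}
    (hp : p ≠ ∞) : MemLp (fun ω ↦ W t ω - W s ω) p P := by
  have hl := hW.law_increment h
  have := memLp_id_gaussianReal' (μ := 0) (v := t - s) p hp
  rw [← hl.map_eq] at this
  exact (memLp_map_measure_iff (by fun_prop) hl.aemeasurable).1 this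

lemma IsWiener.integral_increment (hW : IsWiener 𝓕 P W) {s t : ℝ≥0} (h : s ≤ t) :
    ∫ ω, (W t ω - W s ω) ∂P = 0 := by
  rw [(hW.law_increment h).integral_eq, integral_id_gaussianReal]

lemma IsWiener.integral_increment_sq (hW : IsWiener 𝓕 P W) {s t : ℝ≥0} (h : s ≤ t) :
    ∫ ω, (W t ω - W s ω) ^ 2 ∂P = t - s := by
  have hl := hW.law_increment h
  have := hl.integral_comp (f := fun x ↦ x ^ 2) (by fun_prop)
  simp only [Function.comp_def] at this
  rw [this]
  have hv := variance_fun_id_gaussianReal (μ := 0) (v := t - s)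
  rw [variance_of_integral_eq_zero (by fun_prop) integral_id_gaussianReal] at hv
  rw [hv, NNReal.coe_sub h]

lemma IsWiener.integral_increment_pow_four (hW : IsWiener 𝓕 P W) {s t : ℝ≥0} (h : s ≤ t) :
    ∫ ω, (W t ω - W s ω) ^ 4 ∂P = ((t : ℝ) - s) ^ 2 * ∫ x, x ^ 4 ∂gaussianReal 0 1 := by
  have := (hW.law_increment h).integral_comp (f := fun x ↦ x ^ 4) (by fun_prop)
  simp only [Function.comp_def] at this
  rw [this, integral_pow_four_gaussianReal, NNReal.coe_sub h]

lemma IsPoisson.memLp_increment (hN : IsPoisson 𝓕 P lam N) {s t : ℝ≥0} (h : s ≤ t) :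
    MemLp (fun ω ↦ N t ω - N s ω) 2 P := by
  have hl := hN.law_increment s t h
  have := (memLp_two_iff_integrable_sq (by fun_prop)).2 (integrable_sq_poisson (lam * (t - s)))
  rw [← hl.map_eq] at this
  exact (memLp_map_measure_iff (by fun_prop) hl.aemeasurable).1 this

lemma IsPoisson.integral_increment (hN : IsPoisson 𝓕 P lam N) {s t : ℝ≥0} (h : s ≤ t) :
    ∫ ω, (N t ω - N s ω) ∂P = lam * (t - s) := by
  rw [(hN.law_increment s t h).integral_eq, integral_id_poisson]
  push_cast [NNReal.coe_sub h]
  ring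

lemma IsPoisson.integral_increment_sq (hN : IsPoisson 𝓕 P lam N) {s t : ℝ≥0} (h : s ≤ t) :
    ∫ ω, (N t ω - N s ω) ^ 2 ∂P = lam * (t - s) + (lam * (t - s)) ^ 2 := by
  have := (hN.law_increment s t h).integral_comp (f := fun x ↦ x ^ 2) (by fun_prop)
  simp only [Function.comp_def] at this
  rw [this, integral_sq_poisson]
  push_cast [NNReal.coe_sub h]
  ring

/-- Being integer valued, an increment is either zero or at least one; this dichotomy makes it rare
to see any jump over a short interval. -/
lemma IsPoisson.increment_mem_range (hN : IsPoisson 𝓕 P lam N) {s t : ℝ≥0} (h : s ≤ t) :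
    ∀ᵐ ω ∂P, ∃ n : ℕ, N t ω - N s ω = n := by
  have hl := hN.law_increment s t h
  have hm : MeasurableSet {x : ℝ | ∃ n : ℕ, x = n} := by
    have : {x : ℝ | ∃ n : ℕ, x = n} = Set.range (Nat.cast : ℕ → ℝ) := by
      ext; simp [eq_comm]
    rw [this]
    exact (Set.countable_range _).measurableSet
  refine ae_of_ae_map (p := fun x ↦ ∃ n : ℕ, x = n) hl.aemeasurable ?_
  rw [hl.map_eq, ae_map_iff (by fun_prop) hm]
  exact ae_of_all _ fun n ↦ ⟨n, rfl⟩

lemma IsPoisson.ae_eq_increment (hN : IsPoisson 𝓕 P lam N) (t : ℝ≥0) :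
    N t =ᵐ[P] fun ω ↦ N t ω - N 0 ω := by
  filter_upwards [hN.zero] with ω h
  simp [h]

lemma IsPoisson.memLp (hN : IsPoisson 𝓕 P lam N) (t : ℝ≥0) : MemLp (N t) 2 P :=
  (memLp_congr_ae (hN.ae_eq_increment t)).2 (hN.memLp_increment zero_le)

lemma IsPoisson.integral (hN : IsPoisson 𝓕 P lam N) (t : ℝ≥0) : ∫ ω, N t ω ∂P = lam * t := by
  rw [integral_congr_ae (hN.ae_eq_increment t), hN.integral_increment zero_le]
  simp

lemma IsPoisson.integral_sq (hN : IsPoisson 𝓕 P lam N) (t : ℝ≥0) :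
    ∫ ω, N t ω ^ 2 ∂P = lam * t + (lam * t) ^ 2 := by
  have : (fun ω ↦ N t ω ^ 2) =ᵐ[P] fun ω ↦ (N t ω - N 0 ω) ^ 2 := by
    filter_upwards [hN.ae_eq_increment t] with ω h
    rw [← h]
  rw [integral_congr_ae this, hN.integral_increment_sq zero_le]
  simp

end Increments

/-! ### Joint independence of the increments of `W` and `N` -/

/-- The function `x ↦ exp (i u x)`. -/
noncomputable def character (u x : ℝ) : ℂ := Complex.exp ((u * x : ℝ) * Complex.I)

@[fun_prop]
lemma measurable_character (u : ℝ) : Measurable (character u) := by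
  unfold character
  fun_prop

lemma norm_character (u x : ℝ) : ‖character u x‖ = 1 := Complex.norm_exp_ofReal_mul_I _

lemma character_add (u x y : ℝ) : character u (x + y) = character u x * character u y := by
  simp only [character, ← Complex.exp_add]
  push_cast
  ring_nf

lemma norm_character_sub_one_le (u x : ℝ) : ‖character u x - 1‖ ≤ |u| * |x| := by
  have := Real.norm_exp_I_mul_ofReal_sub_one_le (x := u * x)
  rw [mul_comm, Real.norm_eq_abs, abs_mul] at this
  exact this

lemma norm_character_sub_one_le_two (u x : ℝ) : ‖character u x - 1‖ ≤ 2 := by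
  have := norm_sub_le (character u x) 1
  rw [norm_character] at this
  simpa [one_add_one_eq_two] using this

/-- Split at `|w| = δ`. With `w` and `k` the increments of `W` and `N` over a length `h`, the means
of the two terms are of order `δ h` and `h ^ 2 / δ ^ 3`. Summed over a subdivision, the first stays
of order `δ` and the second vanishes. A second moment of `W`, or Cauchy–Schwarz, would only give
order `h`. -/
lemma abs_mul_natCast_le (w : ℝ) {δ : ℝ} (hδ : 0 < δ) (k : ℕ) :
    |w| * min 1 (k : ℝ) ≤ δ * k + w ^ 4 / δ ^ 3 := by
  have h4 : 0 ≤ w ^ 4 / δ ^ 3 := by positivity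
  rcases Nat.eq_zero_or_pos k with rfl | hk
  · simpa using h4
  · have hk1 : (1 : ℝ) ≤ k := by exact_mod_cast hk
    rw [min_eq_left hk1, mul_one]
    rcases le_total |w| δ with h | h
    · nlinarith
    · have h1 : |w| ≤ w ^ 4 / δ ^ 3 := by
        rw [le_div_iff₀ (by positivity), ← Even.pow_abs (by decide : Even 4) w]
        have : δ ^ 3 ≤ |w| ^ 3 := by gcongr
        nlinarith [abs_nonneg w]
      nlinarith

lemma integral_eq_charFun {P : Measure Ω} {X : Ω → ℝ} {μ : Measure ℝ} (hX : HasLaw X μ P)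
    (u : ℝ) : ∫ ω, character u (X ω) ∂P = charFun μ u := by
  rw [charFun_apply_real]
  have := hX.integral_comp (f := character u) (by fun_prop)
  simp only [Function.comp_def] at this
  rw [this]
  simp [character]

/-- The characteristic function of a centred Gaussian variable with variance `h`. -/
noncomputable def gaussChar (h : ℝ≥0) (v : ℝ) : ℂ := charFun (gaussianReal 0 h) v

/-- The characteristic function of a Poisson variable with mean `r`. -/
noncomputable def poissonChar (r : ℝ≥0) (u : ℝ) : ℂ :=
  charFun ((poissonMeasure r).map (Nat.cast : ℕ → ℝ)) u

lemma norm_gaussChar_le (h : ℝ≥0) (v : ℝ) : ‖gaussChar h v‖ ≤ 1 := norm_charFun_le_one _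

lemma norm_poissonChar_le (r : ℝ≥0) (u : ℝ) : ‖poissonChar r u‖ ≤ 1 :=
  have := Measure.isProbabilityMeasure_map (μ := poissonMeasure r)
    (f := (Nat.cast : ℕ → ℝ)) (by fun_prop)
  norm_charFun_le_one _

/-- Infinite divisibility: the product over equal pieces is exactly the characteristic function for
the whole interval. -/
lemma gaussChar_pow (h : ℝ≥0) (v : ℝ) (m : ℕ) : gaussChar h v ^ m = gaussChar (m * h) v := by
  simp only [gaussChar, charFun_gaussianReal, ← Complex.exp_nat_mul]
  push_cast
  ring_nf

lemma poissonChar_pow (r : ℝ≥0) (u : ℝ) (m : ℕ) : poissonChar r u ^ m = poissonChar (m * r) u := by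
  simp only [poissonChar, charFun_map_cast_poissonMeasure, ← Complex.exp_nat_mul]
  push_cast
  ring_nf

section Joint

variable {𝓕 : Filtration ℝ≥0 mΩ} {P : Measure Ω}
  {W N : ℝ≥0 → Ω → ℝ} {lam : ℝ≥0}

lemma IsWiener.integral_character (hW : IsWiener 𝓕 P W) {s t : ℝ≥0} (h : s ≤ t) (v : ℝ) :
    ∫ ω, character v (W t ω - W s ω) ∂P = gaussChar (t - s) v :=
  integral_eq_charFun (hW.law_increment h) v

lemma IsPoisson.integral_character (hN : IsPoisson 𝓕 P lam N) {s t : ℝ≥0} (h : s ≤ t) (u : ℝ) :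
    ∫ ω, character u (N t ω - N s ω) ∂P = poissonChar (lam * (t - s)) u :=
  integral_eq_charFun (hN.law_increment s t h) u

variable [IsProbabilityMeasure P]

lemma integrable_of_norm_le {f : Ω → ℂ} (hf : Measurable f) {C : ℝ} (h : ∀ ω, ‖f ω‖ ≤ C) :
    Integrable f P :=
  .of_bound hf.aestronglyMeasurable C (ae_of_all _ h)

/-- After expansion, the terms `Z`, `Z x` and `Z y` factorise by the two pairwise independences.
Only the terms containing both `x` and `y` fail to match, and they form the error; nothing is
assumed about `x` and `y` jointly. -/
lemma integral_mul_one_add_mul_one_add {Z x y : Ω → ℂ} (hZ : Measurable Z) (hx : Measurable x)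
    (hy : Measurable y) (hZ1 : ∀ ω, ‖Z ω‖ ≤ 1) (hx2 : ∀ ω, ‖x ω‖ ≤ 2) (hy2 : ∀ ω, ‖y ω‖ ≤ 2)
    (hZx : IndepFun Z x P) (hZy : IndepFun Z y P) :
    ‖∫ ω, Z ω * ((1 + x ω) * (1 + y ω)) ∂P -
        (∫ ω, Z ω ∂P) * ((∫ ω, (1 + x ω) ∂P) * ∫ ω, (1 + y ω) ∂P)‖ ≤
      ∫ ω, ‖x ω‖ * ‖y ω‖ ∂P + (∫ ω, ‖x ω‖ ∂P) * ∫ ω, ‖y ω‖ ∂P := by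
  have iZ : Integrable Z P := integrable_of_norm_le hZ hZ1
  have ix : Integrable x P := integrable_of_norm_le hx hx2
  have iy : Integrable y P := integrable_of_norm_le hy hy2
  have iZx : Integrable (fun ω ↦ Z ω * x ω) P := by
    refine integrable_of_norm_le (by fun_prop) (C := 1 * 2) fun ω ↦ ?_
    rw [norm_mul]
    exact mul_le_mul (hZ1 ω) (hx2 ω) (norm_nonneg _) zero_le_one
  have iZy : Integrable (fun ω ↦ Z ω * y ω) P := by
    refine integrable_of_norm_le (by fun_prop) (C := 1 * 2) fun ω ↦ ?_
    rw [norm_mul]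
    exact mul_le_mul (hZ1 ω) (hy2 ω) (norm_nonneg _) zero_le_one
  have ixy : Integrable (fun ω ↦ x ω * y ω) P := by
    refine integrable_of_norm_le (by fun_prop) (C := 2 * 2) fun ω ↦ ?_
    rw [norm_mul]
    exact mul_le_mul (hx2 ω) (hy2 ω) (norm_nonneg _) zero_le_two
  have iZxy : Integrable (fun ω ↦ Z ω * (x ω * y ω)) P := by
    refine integrable_of_norm_le (by fun_prop) (C := 1 * (2 * 2)) fun ω ↦ ?_
    rw [norm_mul, norm_mul]
    exact mul_le_mul (hZ1 ω) (mul_le_mul (hx2 ω) (hy2 ω) (norm_nonneg _) zero_le_two)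
      (by positivity) zero_le_one
  have i1 : Integrable (fun ω ↦ Z ω + Z ω * x ω) P := iZ.add iZx
  have i2 : Integrable (fun ω ↦ Z ω + Z ω * x ω + Z ω * y ω) P := i1.add iZy
  have e : ∫ ω, Z ω * ((1 + x ω) * (1 + y ω)) ∂P =
      ∫ ω, Z ω ∂P + (∫ ω, Z ω ∂P) * (∫ ω, x ω ∂P) + (∫ ω, Z ω ∂P) * (∫ ω, y ω ∂P) +
        ∫ ω, Z ω * (x ω * y ω) ∂P := by
    rw [← hZx.integral_fun_mul_eq_mul_integral hZ.aestronglyMeasurable hx.aestronglyMeasurable,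
      ← hZy.integral_fun_mul_eq_mul_integral hZ.aestronglyMeasurable hy.aestronglyMeasurable,
      ← integral_add iZ iZx, ← integral_add i1 iZy, ← integral_add i2 iZxy]
    congr with ω
    ring
  have ex : ∫ ω, (1 + x ω) ∂P = 1 + ∫ ω, x ω ∂P := by
    rw [integral_add (integrable_const _) ix]; simp
  have ey : ∫ ω, (1 + y ω) ∂P = 1 + ∫ ω, y ω ∂P := by
    rw [integral_add (integrable_const _) iy]; simp
  have hEZ : ‖∫ ω, Z ω ∂P‖ ≤ 1 := by
    refine (norm_integral_le_integral_norm _).trans ?_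
    refine (integral_mono iZ.norm (integrable_const 1) hZ1).trans ?_
    simp
  rw [e, ex, ey]
  calc _ = ‖∫ ω, Z ω * (x ω * y ω) ∂P - (∫ ω, Z ω ∂P) * ((∫ ω, x ω ∂P) * ∫ ω, y ω ∂P)‖ := by
        congr 1; ring
    _ ≤ ‖∫ ω, Z ω * (x ω * y ω) ∂P‖ + ‖(∫ ω, Z ω ∂P) * ((∫ ω, x ω ∂P) * ∫ ω, y ω ∂P)‖ :=
        norm_sub_le _ _
    _ ≤ _ := by
      gcongr
      · refine (norm_integral_le_integral_norm _).trans ?_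
        have inn : Integrable (fun ω ↦ ‖x ω‖ * ‖y ω‖) P := by simpa using ixy.norm
        refine integral_mono iZxy.norm inn fun ω ↦ ?_
        simp only [norm_mul]
        exact mul_le_of_le_one_left (by positivity) (hZ1 ω)
      · rw [norm_mul, norm_mul]
        refine (mul_le_of_le_one_left (by positivity) hEZ).trans ?_
        gcongr <;> exact norm_integral_le_integral_norm _

lemma norm_mul_sub_mul_le {q : ℂ} (hq : ‖q‖ ≤ 1) (a b : ℂ) : ‖a * q - b * q‖ ≤ ‖a - b‖ := by
  rw [← sub_mul, norm_mul]
  exact mul_le_of_le_one_right (norm_nonneg _) hq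

/-- The fourth moment of the standard Gaussian distribution. -/
noncomputable def gaussFourth : ℝ := ∫ x, x ^ 4 ∂gaussianReal 0 1

/-- Over a short interval, the increments of `W` and `N` are nearly independent. -/
lemma norm_integral_character_mul_le (hW : IsWiener 𝓕 P W) (hN : IsPoisson 𝓕 P lam N)
    {s t : ℝ≥0} (hst : s ≤ t) {Z : Ω → ℂ} (hZ : Measurable[𝓕 s] Z) (hZ1 : ∀ ω, ‖Z ω‖ ≤ 1)
    (v u : ℝ) {δ : ℝ} (hδ : 0 < δ) :
    ‖∫ ω, Z ω * (character v (W t ω - W s ω) * character u (N t ω - N s ω)) ∂P -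
        (∫ ω, Z ω ∂P) * (gaussChar (t - s) v * poissonChar (lam * (t - s)) u)‖ ≤
      2 * |v| * (δ * (lam * (t - s)) + (t - s) ^ 2 * gaussFourth / δ ^ 3) +
        |v| * (δ + (t - s) ^ 2 * gaussFourth / δ ^ 3) * (2 * (lam * (t - s))) := by
  set x : Ω → ℂ := fun ω ↦ character v (W t ω - W s ω) - 1 with hx
  set y : Ω → ℂ := fun ω ↦ character u (N t ω - N s ω) - 1 with hy
  have mW := (hW.measurable t).sub (hW.measurable s)
  have mN := (hN.measurable t).sub (hN.measurable s)
  have hxm : Measurable x := ((measurable_character v).comp mW).sub_const 1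
  have hym : Measurable y := ((measurable_character u).comp mN).sub_const 1
  have hZx : IndepFun Z x P := (hW.indepFun_increment hst hZ).comp measurable_id
    ((measurable_character v).sub_const 1)
  have hZy : IndepFun Z y P := (hN.indepFun_increment hst hZ).comp measurable_id
    ((measurable_character u).sub_const 1)
  have key := integral_mul_one_add_mul_one_add (hZ.mono (𝓕.le s) le_rfl) hxm hym hZ1
    (fun ω ↦ norm_character_sub_one_le_two _ _) (fun ω ↦ norm_character_sub_one_le_two _ _) hZx hZy
  simp only [hx, hy, add_sub_cancel, hW.integral_character hst, hN.integral_character hst] at key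
  refine key.trans ?_
  have i4 : Integrable (fun ω ↦ (W t ω - W s ω) ^ 4) P := by
    have := (hW.memLp_increment hst (p := 4) (by simp)).integrable_norm_pow (by norm_num)
    refine this.congr (ae_of_all _ fun ω ↦ ?_)
    simp [Even.pow_abs (by decide : Even 4)]
  have iN : Integrable (fun ω ↦ N t ω - N s ω) P := (hN.memLp_increment hst).integrable one_le_two
  have hWnorm : Integrable (fun ω ↦ ‖x ω‖) P :=
    (integrable_of_norm_le hxm fun ω ↦ norm_character_sub_one_le_two _ _).norm
  have hNnorm : Integrable (fun ω ↦ ‖y ω‖) P :=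
    (integrable_of_norm_le hym fun ω ↦ norm_character_sub_one_le_two _ _).norm
  have ynat : ∀ᵐ ω ∂P, ∃ k : ℕ, N t ω - N s ω = k ∧ ‖y ω‖ ≤ 2 * min 1 (k : ℝ) := by
    filter_upwards [hN.increment_mem_range hst] with ω ⟨k, hk⟩
    refine ⟨k, hk, ?_⟩
    rcases Nat.eq_zero_or_pos k with rfl | hk0
    · simp only [hy, hk]
      simp [character]
    · rw [min_eq_left (by exact_mod_cast hk0), mul_one]
      exact norm_character_sub_one_le_two _ _
  have h1 : ∫ ω, ‖x ω‖ * ‖y ω‖ ∂P ≤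
      2 * |v| * (δ * (lam * (t - s)) + (t - s) ^ 2 * gaussFourth / δ ^ 3) := by
    calc _ ≤ ∫ ω, 2 * |v| * (δ * (N t ω - N s ω) + (W t ω - W s ω) ^ 4 / δ ^ 3) ∂P := by
          refine integral_mono_of_nonneg (ae_of_all _ fun ω ↦ by positivity)
            (((iN.const_mul δ).add (i4.div_const _)).const_mul _) ?_
          filter_upwards [ynat] with ω ⟨k, hk, hyk⟩
          have hw := abs_mul_natCast_le (W t ω - W s ω) hδ k
          calc _ ≤ (|v| * |W t ω - W s ω|) * (2 * min 1 (k : ℝ)) := by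
                gcongr
                exact norm_character_sub_one_le _ _
            _ = 2 * |v| * (|W t ω - W s ω| * min 1 (k : ℝ)) := by ring
            _ ≤ _ := by rw [hk]; gcongr
      _ = _ := by
          rw [integral_const_mul, integral_add (iN.const_mul δ) (i4.div_const _),
            integral_const_mul, integral_div, hN.integral_increment hst,
            hW.integral_increment_pow_four hst, gaussFourth]
  have h2 : ∫ ω, ‖x ω‖ ∂P ≤ |v| * (δ + (t - s) ^ 2 * gaussFourth / δ ^ 3) := by
    calc _ ≤ ∫ ω, |v| * (δ + (W t ω - W s ω) ^ 4 / δ ^ 3) ∂P := by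
          refine integral_mono hWnorm (((integrable_const δ).add (i4.div_const _)).const_mul _)
            fun ω ↦ ?_
          -- Taking `k = 1` removes the truncation and bounds `|w|` alone.
          have hw := abs_mul_natCast_le (W t ω - W s ω) hδ 1
          simp only [Nat.cast_one, min_self, mul_one] at hw
          refine (norm_character_sub_one_le _ _).trans ?_
          gcongr
      _ = _ := by
          rw [integral_const_mul, integral_add (integrable_const δ) (i4.div_const _),
            integral_div, hW.integral_increment_pow_four hst, gaussFourth]
          simp
  have h3 : ∫ ω, ‖y ω‖ ∂P ≤ 2 * (lam * (t - s)) := by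
    rw [← hN.integral_increment hst, ← integral_const_mul]
    refine integral_mono_ae hNnorm (iN.const_mul 2) ?_
    filter_upwards [ynat] with ω ⟨k, hk, hyk⟩
    rw [hk]
    exact hyk.trans (by gcongr; exact min_le_right _ _)
  have h4 : 0 ≤ |v| * (δ + (t - s) ^ 2 * gaussFourth / δ ^ 3) :=
    (integral_nonneg fun ω ↦ norm_nonneg _).trans h2
  exact add_le_add h1 (mul_le_mul h2 h3 (integral_nonneg fun ω ↦ norm_nonneg _) h4)

/-- The factors of the pieces already treated are absorbed into the past variable, which keeps norm
at most one. Each new piece adds one error, and earlier errors are only multiplied by a number of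
norm at most one. -/
lemma norm_integral_character_mul_sub_le_of_subdivision (hW : IsWiener 𝓕 P W)
    (hN : IsPoisson 𝓕 P lam N) (s h : ℝ≥0) {Z : Ω → ℂ} (hZ : Measurable[𝓕 s] Z)
    (hZ1 : ∀ ω, ‖Z ω‖ ≤ 1) (v u : ℝ) {δ : ℝ} (hδ : 0 < δ) (j : ℕ) :
    ‖∫ ω, Z ω * (character v (W (s + j * h) ω - W s ω) *
          character u (N (s + j * h) ω - N s ω)) ∂P -
        (∫ ω, Z ω ∂P) * (gaussChar h v * poissonChar (lam * h) u) ^ j‖ ≤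
      j * (2 * |v| * (δ * (lam * h) + h ^ 2 * gaussFourth / δ ^ 3) +
        |v| * (δ + h ^ 2 * gaussFourth / δ ^ 3) * (2 * (lam * h))) := by
  induction j with
  | zero => simp [character]
  | succ j ih =>
    set r : ℝ≥0 := s + j * h with hr
    have hr' : s + ((j + 1 : ℕ) : ℝ≥0) * h = r + h := by rw [hr]; push_cast; ring
    have hsr : s ≤ r := le_self_add
    set Y : Ω → ℂ := fun ω ↦ Z ω * (character v (W r ω - W s ω) * character u (N r ω - N s ω))
      with hY
    have hYm : Measurable[𝓕 r] Y := by
      refine (hZ.mono (𝓕.mono hsr) le_rfl).mul (Measurable.mul ?_ ?_)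
      · exact (measurable_character v).comp
          ((hW.adapted r).sub ((hW.adapted s).mono (𝓕.mono hsr) le_rfl))
      · exact (measurable_character u).comp
          ((hN.adapted r).sub ((hN.adapted s).mono (𝓕.mono hsr) le_rfl))
    have hY1 : ∀ ω, ‖Y ω‖ ≤ 1 := fun ω ↦ by simpa [hY, norm_character] using hZ1 ω
    have step := norm_integral_character_mul_le hW hN (le_self_add : r ≤ r + h) hYm hY1 v u hδ
    have hd : ((r + h : ℝ≥0) : ℝ) - r = h := by push_cast; ring
    rw [hd, add_tsub_cancel_left] at step
    have e : ∀ ω, Z ω * (character v (W (s + ((j + 1 : ℕ) : ℝ≥0) * h) ω - W s ω) *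
        character u (N (s + ((j + 1 : ℕ) : ℝ≥0) * h) ω - N s ω)) =
        Y ω * (character v (W (r + h) ω - W r ω) * character u (N (r + h) ω - N r ω)) := by
      intro ω
      rw [hr', hY, ← sub_add_sub_cancel (W (r + h) ω) (W r ω),
        ← sub_add_sub_cancel (N (r + h) ω) (N r ω), character_add, character_add]
      ring
    simp only [e]
    have hq : ‖gaussChar h v * poissonChar (lam * h) u‖ ≤ 1 := by
      rw [norm_mul]
      exact mul_le_one₀ (norm_gaussChar_le _ _) (norm_nonneg _) (norm_poissonChar_le _ _)
    set q := gaussChar h v * poissonChar (lam * h) u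
    rw [pow_succ, ← mul_assoc]
    calc _ ≤ _ := norm_sub_le_norm_sub_add_norm_sub _ ((∫ ω, Y ω ∂P) * q) _
      _ ≤ _ := add_le_add step ((norm_mul_sub_mul_le hq _ _).trans ih)
      _ = _ := by push_cast; ring

/-- A Wiener process and a Poisson process with respect to the same filtration have increments
that are jointly independent of the past and of each other. -/
theorem integral_mul_character_mul_character (hW : IsWiener 𝓕 P W) (hN : IsPoisson 𝓕 P lam N)
    {s t : ℝ≥0} (hst : s ≤ t) {Z : Ω → ℂ} (hZ : Measurable[𝓕 s] Z) (hZ1 : ∀ ω, ‖Z ω‖ ≤ 1)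
    (v u : ℝ) :
    ∫ ω, Z ω * (character v (W t ω - W s ω) * character u (N t ω - N s ω)) ∂P =
      (∫ ω, Z ω ∂P) * (gaussChar (t - s) v * poissonChar (lam * (t - s)) u) := by
  set D := ∫ ω, Z ω * (character v (W t ω - W s ω) * character u (N t ω - N s ω)) ∂P -
      (∫ ω, Z ω ∂P) * (gaussChar (t - s) v * poissonChar (lam * (t - s)) u) with hD
  set ℓ : ℝ := ((t - s : ℝ≥0) : ℝ) with hℓ
  -- The subdivision is refined with `δ` fixed, which removes the terms with `δ ^ 3` in the
  -- denominator; only then may `δ` tend to zero.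
  have bound (δ : ℝ) (hδ : 0 < δ) : ‖D‖ ≤ 4 * |v| * lam * ℓ * δ := by
    have hm (m : ℕ) : ‖D‖ ≤ 2 * |v| * (δ * (lam * ℓ) + ℓ ^ 2 * gaussFourth / δ ^ 3 *
          (1 / ((m : ℝ) + 1))) +
        |v| * (δ + ℓ ^ 2 * gaussFourth / δ ^ 3 * (1 / ((m : ℝ) + 1)) * (1 / ((m : ℝ) + 1))) *
          (2 * (lam * ℓ)) := by
      have hm0 : ((m + 1 : ℕ) : ℝ≥0) ≠ 0 := by positivity
      have h := norm_integral_character_mul_sub_le_of_subdivision hW hN s ((t - s) / (m + 1 : ℕ))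
        hZ hZ1 v u hδ (m + 1)
      have e1 : ((m + 1 : ℕ) : ℝ≥0) * ((t - s) / (m + 1 : ℕ)) = t - s := by field_simp
      have e2 : ((m + 1 : ℕ) : ℝ≥0) * (lam * ((t - s) / (m + 1 : ℕ))) = lam * (t - s) := by
        rw [mul_left_comm, e1]
      rw [mul_pow, gaussChar_pow, poissonChar_pow, e1, e2, add_tsub_cancel_of_le hst] at h
      refine h.trans (le_of_eq ?_)
      push_cast
      rw [← hℓ]
      have : (m : ℝ) + 1 ≠ 0 := by positivity
      field_simp
    have h0 : Tendsto (fun m : ℕ ↦ 1 / ((m : ℝ) + 1)) atTop (𝓝 0) :=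
      tendsto_one_div_add_atTop_nhds_zero_nat
    have lim := (((h0.const_mul (ℓ ^ 2 * gaussFourth / δ ^ 3)).const_add
      (δ * (lam * ℓ))).const_mul (2 * |v|)).add
      (((((h0.const_mul (ℓ ^ 2 * gaussFourth / δ ^ 3)).mul h0).const_add δ).const_mul
        |v|).mul_const (2 * (lam * ℓ)))
    refine (ge_of_tendsto' lim hm).trans (le_of_eq ?_)
    ring
  have : ‖D‖ ≤ 0 := by
    have lim : Tendsto (fun δ : ℝ ↦ 4 * |v| * lam * ℓ * δ) (𝓝[>] 0) (𝓝 0) := by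
      have : Tendsto (fun δ : ℝ ↦ 4 * |v| * lam * ℓ * δ) (𝓝 0) (𝓝 (4 * |v| * lam * ℓ * 0)) :=
        (continuous_const.mul continuous_id).tendsto 0
      rw [mul_zero] at this
      exact this.mono_left nhdsWithin_le_nhds
    exact ge_of_tendsto lim (eventually_nhdsWithin_of_forall bound)
  exact sub_eq_zero.1 (norm_le_zero_iff.1 this)

end Joint

/-! ### The joint law of the increments over a grid -/

/-- The vector of the first `m` increments of `X` over the grid `s`. -/
def increments (X : ℝ≥0 → Ω → ℝ) (s : ℕ → ℝ≥0) (m : ℕ) (ω : Ω) : Fin m → ℝ :=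
  fun p ↦ X (s (p + 1)) ω - X (s p) ω

lemma measurable_increments {X : ℝ≥0 → Ω → ℝ} (hX : ∀ t, Measurable (X t)) (s : ℕ → ℝ≥0) (m : ℕ) :
    Measurable (increments X s m) :=
  measurable_pi_lambda _ fun _ ↦ (hX _).sub (hX _)

section Grid

variable {𝓕 : Filtration ℝ≥0 mΩ} {P : Measure Ω} [IsProbabilityMeasure P]
  {W N : ℝ≥0 → Ω → ℝ} {lam : ℝ≥0} {s : ℕ → ℝ≥0}

/-- Induction on the number of intervals: the factors of the earlier intervals serve as the bounded
past variable `Z` for the last one. -/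
lemma integral_prod_character (hW : IsWiener 𝓕 P W) (hN : IsPoisson 𝓕 P lam N) (hs : Monotone s)
    (m : ℕ) (u v : Fin m → ℝ) :
    ∫ ω, ∏ p, (character (v p) (increments W s m ω p) * character (u p) (increments N s m ω p)) ∂P =
      ∏ p : Fin m, (gaussChar (s (p + 1) - s p) (v p) *
        poissonChar (lam * (s (p + 1) - s p)) (u p)) := by
  induction m with
  | zero => simp
  | succ m ih =>
    simp only [Fin.prod_univ_castSucc]
    have key := integral_mul_character_mul_character hW hN (hs (Nat.le_succ m))
      (Z := fun ω ↦ ∏ p : Fin m, (character (v p.castSucc) (increments W s m ω p) *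
        character (u p.castSucc) (increments N s m ω p))) ?_ ?_ (v (Fin.last m)) (u (Fin.last m))
    · rw [ih] at key
      exact key
    · refine Finset.measurable_prod _ fun p _ ↦ Measurable.mul ?_ ?_
      · exact (measurable_character _).comp
          (((hW.adapted _).mono (𝓕.mono (hs p.2)) le_rfl).sub
            ((hW.adapted _).mono (𝓕.mono (hs p.2.le)) le_rfl))
      · exact (measurable_character _).comp
          (((hN.adapted _).mono (𝓕.mono (hs p.2)) le_rfl).sub
            ((hN.adapted _).mono (𝓕.mono (hs p.2.le)) le_rfl))
    · intro ω
      rw [norm_prod]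
      simp [norm_character]

lemma strongDual_pi_apply {m : ℕ} (L : StrongDual ℝ (Fin m → ℝ)) (x : Fin m → ℝ) :
    L x = ∑ p, L (Pi.single p 1) * x p := by
  conv_lhs => rw [← Finset.univ_sum_single x, map_sum]
  refine Finset.sum_congr rfl fun p _ ↦ ?_
  have : Pi.single p (x p) = x p • (Pi.single p 1 : Fin m → ℝ) := by
    rw [← Pi.single_smul, smul_eq_mul, mul_one]
  rw [this, map_smul, smul_eq_mul, mul_comm]

lemma cexp_eq_prod_character {m : ℕ} (u v x y : Fin m → ℝ) :
    Complex.exp ((∑ p, u p * x p + ∑ p, v p * y p : ℝ) * Complex.I) =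
      ∏ p, (character (v p) (y p) * character (u p) (x p)) := by
  simp only [character, ← Complex.exp_add, ← Complex.exp_sum]
  rw [← Finset.sum_add_distrib]
  push_cast
  rw [Finset.sum_mul]
  congr 1
  refine Finset.sum_congr rfl fun p _ ↦ ?_
  ring

/-- The characteristic function of the law of the increments, possibly reordered among grid
intervals of the same length. -/
lemma charFunDual_increments (hW : IsWiener 𝓕 P W) (hN : IsPoisson 𝓕 P lam N) (hs : Monotone s)
    {m : ℕ} {σ τ : Equiv.Perm (Fin m)} (hσ : ∀ p : Fin m, s (σ p + 1) - s (σ p) = s (p + 1) - s p)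
    (hτ : ∀ p : Fin m, s (τ p + 1) - s (τ p) = s (p + 1) - s p)
    (L : StrongDual ℝ ((Fin m → ℝ) × (Fin m → ℝ))) :
    charFunDual (P.map fun ω ↦ (increments N s m ω ∘ σ, increments W s m ω ∘ τ)) L =
      (∏ p : Fin m, poissonChar (lam * (s (p + 1) - s p)) (L (Pi.single p 1, 0))) *
        ∏ p : Fin m, gaussChar (s (p + 1) - s p) (L (0, Pi.single p 1)) := by
  have hm : Measurable fun ω ↦ (increments N s m ω ∘ σ, increments W s m ω ∘ τ) := by
    refine Measurable.prodMk ?_ ?_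
    · exact measurable_pi_lambda _ fun p ↦
        (measurable_pi_apply (σ p)).comp (measurable_increments hN.measurable s m)
    · exact measurable_pi_lambda _ fun p ↦
        (measurable_pi_apply (τ p)).comp (measurable_increments hW.measurable s m)
  rw [charFunDual_apply, integral_map hm.aemeasurable (by fun_prop)]
  have hL (x y : Fin m → ℝ) : L (x, y) =
      ∑ p, L (Pi.single p 1, 0) * x p + ∑ p, L (0, Pi.single p 1) * y p := by
    have h1 := strongDual_pi_apply (L.comp (.inl ℝ _ _)) x
    have h2 := strongDual_pi_apply (L.comp (.inr ℝ _ _)) y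
    simp only [ContinuousLinearMap.comp_apply, ContinuousLinearMap.inl_apply,
      ContinuousLinearMap.inr_apply] at h1 h2
    rw [← h1, ← h2, ← map_add]
    simp
  -- The permutations are moved from the increments to the coefficients of `L`, so that the product
  -- formula applies to the increments in their natural order.
  have key := integral_prod_character hW hN hs m (fun p ↦ L (Pi.single (σ.symm p) 1, 0))
    (fun p ↦ L (0, Pi.single (τ.symm p) 1))
  simp only [← cexp_eq_prod_character] at key
  have e1 (x : Fin m → ℝ) : ∑ p, L (Pi.single (σ.symm p) 1, 0) * x p =
      ∑ p, L (Pi.single p 1, 0) * x (σ p) := by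
    rw [← Equiv.sum_comp σ]; simp
  have e2 (x : Fin m → ℝ) : ∑ p, L (0, Pi.single (τ.symm p) 1) * x p =
      ∑ p, L (0, Pi.single p 1) * x (τ p) := by
    rw [← Equiv.sum_comp τ]; simp
  simp only [e1, e2] at key
  have e3 (ω : Ω) : Complex.exp (L (increments N s m ω ∘ σ, increments W s m ω ∘ τ) * Complex.I) =
      Complex.exp ((∑ p, L (Pi.single p 1, 0) * increments N s m ω (σ p) +
        ∑ p, L (0, Pi.single p 1) * increments W s m ω (τ p) : ℝ) * Complex.I) := by
    rw [hL]
    rfl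
  rw [integral_congr_ae (ae_of_all _ e3), key, Finset.prod_mul_distrib, mul_comm]
  congr 1
  · rw [← Equiv.prod_comp σ]
    simp [hσ]
  · rw [← Equiv.prod_comp τ]
    simp [hτ]

/-- The joint law of the increments does not change if the increments of `N` and those of `W` are
reordered among grid intervals of the same length. -/
theorem map_increments_perm (hW : IsWiener 𝓕 P W) (hN : IsPoisson 𝓕 P lam N) (hs : Monotone s)
    {m : ℕ} {σ τ : Equiv.Perm (Fin m)} (hσ : ∀ p : Fin m, s (σ p + 1) - s (σ p) = s (p + 1) - s p)
    (hτ : ∀ p : Fin m, s (τ p + 1) - s (τ p) = s (p + 1) - s p) :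
    P.map (fun ω ↦ (increments N s m ω ∘ σ, increments W s m ω ∘ τ)) =
      P.map fun ω ↦ (increments N s m ω, increments W s m ω) := by
  refine Measure.ext_of_charFunDual (funext fun L ↦ ?_)
  rw [charFunDual_increments hW hN hs hσ hτ]
  exact (charFunDual_increments hW hN hs (σ := 1) (τ := 1) (fun _ ↦ rfl) (fun _ ↦ rfl) L).symm

/-- The increments of `N` are independent of those of `W`. -/
theorem indepFun_increments (hW : IsWiener 𝓕 P W) (hN : IsPoisson 𝓕 P lam N) (hs : Monotone s)
    (m : ℕ) : IndepFun (increments N s m) (increments W s m) P := by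
  have hNm := measurable_increments hN.measurable s m
  have hWm := measurable_increments hW.measurable s m
  rw [indepFun_iff_charFunDual_prod hNm.aemeasurable hWm.aemeasurable]
  have joint := charFunDual_increments hW hN hs (m := m) (σ := 1) (τ := 1)
    (fun _ ↦ rfl) (fun _ ↦ rfl)
  change ∀ L, charFunDual (P.map fun ω ↦ (increments N s m ω, increments W s m ω)) L = _ at joint
  -- The marginals are images of the joint law under the projections; in their characteristic
  -- functions the factors of the other process are all one.
  have h1 : P.map (increments N s m) =
      (P.map fun ω ↦ (increments N s m ω, increments W s m ω)).map (ContinuousLinearMap.fst ℝ _ _) := by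
    rw [Measure.map_map (by fun_prop) (hNm.prodMk hWm)]; rfl
  have h2 : P.map (increments W s m) =
      (P.map fun ω ↦ (increments N s m ω, increments W s m ω)).map (ContinuousLinearMap.snd ℝ _ _) := by
    rw [Measure.map_map (by fun_prop) (hNm.prodMk hWm)]; rfl
  intro L
  rw [h1, h2, charFunDual_map, charFunDual_map, joint, joint, joint]
  have h0 : L (0, 0) = 0 := map_zero L
  simp [gaussChar, poissonChar, h0]

end Grid

/-! ### The Itô isometry -/

/-- The product of the Lebesgue measure on `(0, T]` with `P`. -/
noncomputable abbrev timeMeasure (T : ℝ≥0) (P : Measure Ω) : Measure (ℝ × Ω) :=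
  ((volume : Measure ℝ).restrict (Set.Ioc 0 (T : ℝ))).prod P

/-- The process that equals `ξ` on `(a, b]` and vanishes elsewhere. -/
noncomputable def step (a b : ℝ≥0) (ξ : Ω → ℝ) (q : ℝ × Ω) : ℝ :=
  (Set.Ioc (a : ℝ) b).indicator 1 q.1 * ξ q.2

/-- The pairs formed by a square integrable step process on `(0, T]` and its elementary stochastic
integral. -/
noncomputable def itoPairs (𝓕 : Filtration ℝ≥0 mΩ) (P : Measure Ω) (W : ℝ≥0 → Ω → ℝ) (T : ℝ≥0) :
    Submodule ℝ ((ℝ × Ω → ℝ) × (Ω → ℝ)) :=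
  Submodule.span ℝ {p | ∃ (a b : ℝ≥0) (ξ : Ω → ℝ), a ≤ b ∧ b ≤ T ∧ Measurable[𝓕 a] ξ ∧
    MemLp ξ 2 P ∧ p = (step a b ξ, fun ω ↦ ξ ω * (W b ω - W a ω))}

lemma eLpNorm_two_eq {α : Type*} {m : MeasurableSpace α} {μ : Measure α} {f : α → ℝ}
    (hf : MemLp f 2 μ) : eLpNorm f 2 μ = ENNReal.ofReal √(∫ x, f x ^ 2 ∂μ) := by
  rw [hf.eLpNorm_eq_integral_rpow_norm (by simp) (by simp), Real.sqrt_eq_rpow]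
  simp

section Isometry

variable {𝓕 : Filtration ℝ≥0 mΩ} {P : Measure Ω} {W : ℝ≥0 → Ω → ℝ} {T : ℝ≥0}

lemma IsWiener.integral_mul_increment (hW : IsWiener 𝓕 P W) {s t : ℝ≥0} (h : s ≤ t) {G : Ω → ℝ}
    (hG : Measurable[𝓕 s] G) : ∫ ω, G ω * (W t ω - W s ω) ∂P = 0 := by
  rw [(hW.indepFun_increment h hG).integral_fun_mul_eq_mul_integral
    (hG.mono (𝓕.le s) le_rfl).aestronglyMeasurable
    ((hW.measurable t).sub (hW.measurable s)).aestronglyMeasurable, hW.integral_increment h,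
    mul_zero]

lemma IsWiener.integral_mul_increment_sq (hW : IsWiener 𝓕 P W) {s t : ℝ≥0} (h : s ≤ t)
    {G : Ω → ℝ} (hG : Measurable[𝓕 s] G) :
    ∫ ω, G ω * (W t ω - W s ω) ^ 2 ∂P = (∫ ω, G ω ∂P) * (t - s) := by
  have hi : IndepFun G (fun ω ↦ (W t ω - W s ω) ^ 2) P :=
    (hW.indepFun_increment h hG).comp measurable_id (measurable_id.pow_const 2)
  rw [hi.integral_fun_mul_eq_mul_integral (hG.mono (𝓕.le s) le_rfl).aestronglyMeasurable
    (((hW.measurable t).sub (hW.measurable s)).pow_const 2).aestronglyMeasurable,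
    hW.integral_increment_sq h]

/-- The squares are independent and integrable, so their product is integrable; without independence
only integrability of the product itself would follow. -/
lemma memLp_two_mul_of_indepFun {X Y : Ω → ℝ} (hXY : IndepFun X Y P) (hX : MemLp X 2 P)
    (hY : MemLp Y 2 P) : MemLp (fun ω ↦ X ω * Y ω) 2 P := by
  have hm : AEStronglyMeasurable (fun ω ↦ X ω * Y ω) P := hX.1.mul hY.1
  rw [memLp_two_iff_integrable_sq hm]
  have hi : IndepFun (fun ω ↦ X ω ^ 2) (fun ω ↦ Y ω ^ 2) P :=
    hXY.comp (measurable_id.pow_const 2) (measurable_id.pow_const 2)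
  refine (hi.integrable_mul hX.integrable_sq hY.integrable_sq).congr (ae_of_all _ fun ω ↦ ?_)
  simp [mul_pow]

lemma IsWiener.memLp_mul_increment (hW : IsWiener 𝓕 P W) {s t : ℝ≥0} (h : s ≤ t) {ξ : Ω → ℝ}
    (hξ : Measurable[𝓕 s] ξ) (hξ2 : MemLp ξ 2 P) :
    MemLp (fun ω ↦ ξ ω * (W t ω - W s ω)) 2 P :=
  memLp_two_mul_of_indepFun (hW.indepFun_increment h hξ) hξ2 (hW.memLp_increment h (by simp))

lemma integral_add_mul_of_memLp {α : Type*} {m : MeasurableSpace α} {μ : Measure α} {f g h : α → ℝ}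
    (hf : MemLp f 2 μ) (hg : MemLp g 2 μ) (hh : MemLp h 2 μ) :
    ∫ x, (f x + g x) * h x ∂μ = ∫ x, f x * h x ∂μ + ∫ x, g x * h x ∂μ := by
  have i1 : Integrable (fun x ↦ f x * h x) μ := hf.integrable_mul hh
  have i2 : Integrable (fun x ↦ g x * h x) μ := hg.integrable_mul hh
  rw [← integral_add i1 i2]
  simp only [add_mul]

lemma integral_mul_add_of_memLp {α : Type*} {m : MeasurableSpace α} {μ : Measure α} {f g h : α → ℝ}
    (hf : MemLp f 2 μ) (hg : MemLp g 2 μ) (hh : MemLp h 2 μ) :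
    ∫ x, h x * (f x + g x) ∂μ = ∫ x, h x * f x ∂μ + ∫ x, h x * g x ∂μ := by
  simpa only [mul_comm (h _)] using integral_add_mul_of_memLp hf hg hh

lemma integral_indicator_one_mul {a b c d : ℝ} (h : Set.Ioc a b ∩ Set.Ioc c d ⊆ Set.Ioc 0 (T : ℝ)) :
    ∫ t in Set.Ioc 0 (T : ℝ), (Set.Ioc a b).indicator (1 : ℝ → ℝ) t *
      (Set.Ioc c d).indicator (1 : ℝ → ℝ) t = volume.real (Set.Ioc a b ∩ Set.Ioc c d) := by
  have : ∀ t, (Set.Ioc a b).indicator (1 : ℝ → ℝ) t * (Set.Ioc c d).indicator (1 : ℝ → ℝ) t =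
      (Set.Ioc a b ∩ Set.Ioc c d).indicator 1 t := fun t ↦ by
    rw [Set.inter_indicator_one]; rfl
  simp only [this]
  rw [integral_indicator_one (measurableSet_Ioc.inter measurableSet_Ioc), measureReal_def,
    Measure.restrict_apply (measurableSet_Ioc.inter measurableSet_Ioc),
    Set.inter_eq_left.2 h, measureReal_def]

lemma memLp_step {a b : ℝ≥0} {ξ : Ω → ℝ} (hξ2 : MemLp ξ 2 P) :
    MemLp (step a b ξ) 2 (timeMeasure T P) := by
  have h1 : MemLp ((Set.Ioc (a : ℝ) b).indicator (1 : ℝ → ℝ)) 2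
      ((volume : Measure ℝ).restrict (Set.Ioc 0 (T : ℝ))) :=
    memLp_indicator_const 2 measurableSet_Ioc (1 : ℝ) (Or.inr (measure_ne_top _ _))
  have hm : AEStronglyMeasurable (step a b ξ) (timeMeasure T P) :=
    h1.1.comp_fst.mul hξ2.1.comp_snd
  rw [memLp_two_iff_integrable_sq hm]
  refine (h1.integrable_sq.mul_prod hξ2.integrable_sq).congr (ae_of_all _ fun q ↦ ?_)
  simp [step, mul_pow]

lemma integral_step_mul_step {a b c d : ℝ≥0} {ξ η : Ω → ℝ} [SFinite P]
    (hb : b ≤ T) :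
    ∫ q, step a b ξ q * step c d η q ∂timeMeasure T P =
      volume.real (Set.Ioc (a : ℝ) b ∩ Set.Ioc (c : ℝ) d) * ∫ ω, ξ ω * η ω ∂P := by
  have hsub : Set.Ioc (a : ℝ) b ∩ Set.Ioc (c : ℝ) d ⊆ Set.Ioc 0 (T : ℝ) := fun t ht ↦
    ⟨a.coe_nonneg.trans_lt ht.1.1, ht.1.2.trans (by exact_mod_cast hb)⟩
  rw [← integral_indicator_one_mul hsub, ← integral_prod_mul]
  congr with q
  simp only [step]
  ring

/-- Everything known at time `c` is orthogonal to later increments of `W`, so only the overlap of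
the two intervals contributes, through the variance of the increment over it. -/
lemma integral_step_mul_integral_step_aux (hW : IsWiener 𝓕 P W) {a b c d : ℝ≥0} {ξ η : Ω → ℝ}
    (hcd : c ≤ d) (hac : a ≤ c) (hξ : Measurable[𝓕 a] ξ) (hη : Measurable[𝓕 c] η)
    (hξ2 : MemLp ξ 2 P) (hη2 : MemLp η 2 P) :
    ∫ ω, (ξ ω * (W b ω - W a ω)) * (η ω * (W d ω - W c ω)) ∂P =
      volume.real (Set.Ioc (a : ℝ) b ∩ Set.Ioc (c : ℝ) d) * ∫ ω, ξ ω * η ω ∂P := by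
  have mW {r t : ℝ≥0} (h : r ≤ t) : Measurable[𝓕 t] (W r) := (hW.adapted r).mono (𝓕.mono h) le_rfl
  have hξc : Measurable[𝓕 c] ξ := hξ.mono (𝓕.mono hac) le_rfl
  have zero {e : ℝ≥0} (he : e ≤ c) :
      ∫ ω, (ξ ω * (W e ω - W a ω)) * (η ω * (W d ω - W c ω)) ∂P = 0 := by
    rw [← hW.integral_mul_increment hcd (G := fun ω ↦ ξ ω * (W e ω - W a ω) * η ω)
      ((hξc.mul ((mW he).sub (mW hac))).mul hη)]
    congr with ω
    ring
  rcases le_total b c with hbc | hcb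
  · rw [zero hbc]
    have : Set.Ioc (a : ℝ) b ∩ Set.Ioc (c : ℝ) d = ∅ := by
      ext t
      simp only [Set.mem_inter_iff, Set.mem_Ioc, Set.mem_empty_iff_false, iff_false, not_and]
      intro h1 h2
      have : (b : ℝ) ≤ c := by exact_mod_cast hbc
      linarith [h1.2]
    simp [this]
  · have hinter : Set.Ioc (a : ℝ) b ∩ Set.Ioc (c : ℝ) d = Set.Ioc (c : ℝ) (min b d) := by
      rw [Set.Ioc_inter_Ioc, max_eq_right (by exact_mod_cast hac)]
    have hle : (c : ℝ) ≤ min (b : ℝ) d := by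
      rw [le_min_iff]; exact ⟨by exact_mod_cast hcb, by exact_mod_cast hcd⟩
    rw [hinter, Real.volume_real_Ioc_of_le hle]
    have l1 := hW.memLp_mul_increment hac hξ hξ2
    have l2 := hW.memLp_mul_increment hcb hξc hξ2
    have l3 := hW.memLp_mul_increment hcd hη hη2
    have split : ∫ ω, (ξ ω * (W b ω - W a ω)) * (η ω * (W d ω - W c ω)) ∂P =
        ∫ ω, (ξ ω * (W b ω - W c ω)) * (η ω * (W d ω - W c ω)) ∂P := by
      rw [← zero_add (∫ ω, (ξ ω * (W b ω - W c ω)) * (η ω * (W d ω - W c ω)) ∂P),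
        ← zero le_rfl, ← integral_add_mul_of_memLp l1 l2 l3]
      congr with ω
      ring
    -- Both increments now start at `c`; the part of the longer one beyond `x` is orthogonal to the
    -- shorter one.
    have main {x y : ℝ≥0} {ζ θ : Ω → ℝ} (hcx : c ≤ x) (hxy : x ≤ y) (hζ : Measurable[𝓕 c] ζ)
        (hθ : Measurable[𝓕 c] θ) (hζ2 : MemLp ζ 2 P) (hθ2 : MemLp θ 2 P) :
        ∫ ω, (ζ ω * (W x ω - W c ω)) * (θ ω * (W y ω - W c ω)) ∂P =
          (x - c) * ∫ ω, ζ ω * θ ω ∂P := by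
      have e1 := hW.integral_mul_increment_sq hcx (hζ.mul hθ)
      have e2 := hW.integral_mul_increment hxy (G := fun ω ↦ ζ ω * (W x ω - W c ω) * θ ω)
        (((hζ.mono (𝓕.mono hcx) le_rfl).mul ((mW le_rfl).sub (mW hcx))).mul
          (hθ.mono (𝓕.mono hcx) le_rfl))
      have i1 : Integrable (fun ω ↦ (ζ ω * (W x ω - W c ω)) * (θ ω * (W x ω - W c ω))) P :=
        (hW.memLp_mul_increment hcx hζ hζ2).integrable_mul (hW.memLp_mul_increment hcx hθ hθ2)
      have i2 : Integrable (fun ω ↦ (ζ ω * (W x ω - W c ω)) * (θ ω * (W y ω - W x ω))) P :=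
        (hW.memLp_mul_increment hcx hζ hζ2).integrable_mul
          (hW.memLp_mul_increment hxy (hθ.mono (𝓕.mono hcx) le_rfl) hθ2)
      rw [mul_comm]
      calc _ = ∫ ω, ((ζ ω * (W x ω - W c ω)) * (θ ω * (W x ω - W c ω)) +
            (ζ ω * (W x ω - W c ω)) * (θ ω * (W y ω - W x ω))) ∂P := by
            congr with ω; ring
        _ = ∫ ω, (ζ * θ) ω * (W x ω - W c ω) ^ 2 ∂P +
            ∫ ω, ζ ω * (W x ω - W c ω) * θ ω * (W y ω - W x ω) ∂P := by
            rw [integral_add i1 i2]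
            congr 2
            · ext ω; simp only [Pi.mul_apply]; ring
            · ext ω; ring
        _ = _ := by rw [e1, e2, add_zero]; rfl
    rw [split]
    rcases le_total b d with hbd | hdb
    · rw [main hcb hbd hξc hη hξ2 hη2, min_eq_left (by exact_mod_cast hbd)]
    · rw [min_eq_right (by exact_mod_cast hdb)]
      simp only [mul_comm (ξ _)]
      have := main hcd hdb hη hξc hη2 hξ2
      rw [← this]
      congr with ω
      ring

lemma integral_step_mul_integral_step (hW : IsWiener 𝓕 P W) {a b c d : ℝ≥0} {ξ η : Ω → ℝ}
    (hab : a ≤ b) (hcd : c ≤ d) (hξ : Measurable[𝓕 a] ξ) (hη : Measurable[𝓕 c] η)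
    (hξ2 : MemLp ξ 2 P) (hη2 : MemLp η 2 P) :
    ∫ ω, (ξ ω * (W b ω - W a ω)) * (η ω * (W d ω - W c ω)) ∂P =
      volume.real (Set.Ioc (a : ℝ) b ∩ Set.Ioc (c : ℝ) d) * ∫ ω, ξ ω * η ω ∂P := by
  rcases le_total a c with h | h
  · exact integral_step_mul_integral_step_aux hW hcd h hξ hη hξ2 hη2
  · rw [Set.inter_comm]
    simp_rw [mul_comm (ξ _ * _), mul_comm (ξ _) (η _)]
    exact integral_step_mul_integral_step_aux hW hab h hη hξ hη2 hξ2

lemma memLp_of_mem_itoPairs (hW : IsWiener 𝓕 P W) {p : (ℝ × Ω → ℝ) × (Ω → ℝ)}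
    (hp : p ∈ itoPairs 𝓕 P W T) : MemLp p.1 2 (timeMeasure T P) ∧ MemLp p.2 2 P := by
  induction hp using Submodule.span_induction with
  | mem p hp =>
    obtain ⟨a, b, ξ, hab, -, hξ, hξ2, rfl⟩ := hp
    exact ⟨memLp_step hξ2, hW.memLp_mul_increment hab hξ hξ2⟩
  | zero => exact ⟨MemLp.zero, MemLp.zero⟩
  | add p q _ _ hp hq => exact ⟨hp.1.add hq.1, hp.2.add hq.2⟩
  | smul c p _ hp => exact ⟨hp.1.const_smul c, hp.2.const_smul c⟩

variable [SFinite P]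

/-- Both sides are bilinear, so the identity has to be checked only on the generators, where both
sides are the length of the overlap times the mean of `ξ η`. -/
lemma integral_mul_of_mem_itoPairs (hW : IsWiener 𝓕 P W) {p q : (ℝ × Ω → ℝ) × (Ω → ℝ)}
    (hp : p ∈ itoPairs 𝓕 P W T) (hq : q ∈ itoPairs 𝓕 P W T) :
    ∫ ω, p.2 ω * q.2 ω ∂P = ∫ x, p.1 x * q.1 x ∂timeMeasure T P := by
  induction hp using Submodule.span_induction with
  | mem p hp =>
    obtain ⟨a, b, ξ, hab, hb, hξ, hξ2, rfl⟩ := hp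
    induction hq using Submodule.span_induction with
    | mem q hq =>
      obtain ⟨c, d, η, hcd, -, hη, hη2, rfl⟩ := hq
      rw [integral_step_mul_step hb]
      exact integral_step_mul_integral_step hW hab hcd hξ hη hξ2 hη2
    | zero => simp
    | add q r hq hr ihq ihr =>
      have l1 : MemLp (step a b ξ) 2 (timeMeasure T P) := memLp_step hξ2
      have l2 := hW.memLp_mul_increment hab hξ hξ2
      have mq := memLp_of_mem_itoPairs hW hq
      have mr := memLp_of_mem_itoPairs hW hr
      simp only [Prod.fst_add, Prod.snd_add, Pi.add_apply]
      rw [integral_mul_add_of_memLp mq.2 mr.2 l2, integral_mul_add_of_memLp mq.1 mr.1 l1, ihq, ihr]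
    | smul c q _ ihq =>
      simp only [Prod.smul_fst, Prod.smul_snd, Pi.smul_apply, smul_eq_mul, mul_left_comm _ c] at ihq ⊢
      rw [integral_const_mul, integral_const_mul, ihq]
  | zero => simp
  | add p r hp hr ihp ihr =>
    have mq := memLp_of_mem_itoPairs hW hq
    have mp := memLp_of_mem_itoPairs hW hp
    have mr := memLp_of_mem_itoPairs hW hr
    simp only [Prod.fst_add, Prod.snd_add, Pi.add_apply]
    rw [integral_add_mul_of_memLp mp.2 mr.2 mq.2, integral_add_mul_of_memLp mp.1 mr.1 mq.1, ihp, ihr]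
  | smul c p _ ihp =>
    simp only [Prod.smul_fst, Prod.smul_snd, Pi.smul_apply, smul_eq_mul, mul_assoc] at ihp ⊢
    rw [integral_const_mul, integral_const_mul, ihp]

/-- The Itô isometry for step processes. -/
theorem eLpNorm_of_mem_itoPairs (hW : IsWiener 𝓕 P W) {p : (ℝ × Ω → ℝ) × (Ω → ℝ)}
    (hp : p ∈ itoPairs 𝓕 P W T) : eLpNorm p.2 2 P = eLpNorm p.1 2 (timeMeasure T P) := by
  have hm := memLp_of_mem_itoPairs hW hp
  rw [eLpNorm_two_eq hm.1, eLpNorm_two_eq hm.2]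
  simp only [sq, integral_mul_of_mem_itoPairs hW hp hp]

end Isometry

/-! ### Itô integrals as limits of Riemann sums -/

section Ito

variable {𝓕 : Filtration ℝ≥0 mΩ} {P : Measure Ω} {W N : ℝ≥0 → Ω → ℝ} {T lam : ℝ≥0}

lemma eLpNorm_two_sq {α : Type*} {m : MeasurableSpace α} {μ : Measure α} (f : α → ℝ) :
    eLpNorm f 2 μ ^ 2 = ∫⁻ x, ‖f x‖ₑ ^ 2 ∂μ := by
  have := eLpNorm_nnreal_pow_eq_lintegral (f := f) (μ := μ) (p := 2) two_ne_zero
  simpa using this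

lemma eLpNorm_timeMeasure_sq [SFinite P] {f : ℝ × Ω → ℝ}
    (hf : AEStronglyMeasurable f (timeMeasure T P)) :
    eLpNorm f 2 (timeMeasure T P) ^ 2 =
      ∫⁻ t in Set.Ioc 0 (T : ℝ), eLpNorm (fun ω ↦ f (t, ω)) 2 P ^ 2 := by
  simp only [eLpNorm_two_sq]
  rw [timeMeasure, lintegral_prod _ (hf.enorm.pow_const 2)]

lemma eLpNorm_sub_le_add_of_tendsto {α : Type*} {m : MeasurableSpace α} {μ : Measure α}
    {f k : α → ℝ} {g : ℕ → α → ℝ} {c : ℕ → ℝ≥0∞} {C : ℝ≥0∞} (hf : AEStronglyMeasurable f μ)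
    (hk : AEStronglyMeasurable k μ) (hg : ∀ j, AEStronglyMeasurable (g j) μ)
    (h : Tendsto (fun j ↦ eLpNorm (fun x ↦ f x - g j x) 2 μ) atTop (𝓝 0))
    (hc : Tendsto c atTop (𝓝 0)) (hgk : ∀ j, eLpNorm (fun x ↦ g j x - k x) 2 μ ≤ c j + C) :
    eLpNorm (fun x ↦ f x - k x) 2 μ ≤ C := by
  have lim := h.add (hc.add_const C)
  rw [zero_add, zero_add] at lim
  refine ge_of_tendsto' lim fun j ↦ ?_
  refine le_trans ?_ (add_le_add le_rfl (hgk j))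
  refine le_trans (le_of_eq ?_) (eLpNorm_add_le (hf.sub (hg j)) ((hg j).sub hk) one_le_two)
  congr 1
  ext x
  simp

lemma eLpNorm_sub_le_sub_add_sub {α : Type*} {m : MeasurableSpace α} {μ : Measure α}
    {f k g : α → ℝ} (hf : AEStronglyMeasurable f μ) (hk : AEStronglyMeasurable k μ)
    (hg : AEStronglyMeasurable g μ) :
    eLpNorm (fun x ↦ g x - k x) 2 μ ≤
      eLpNorm (fun x ↦ f x - g x) 2 μ + eLpNorm (fun x ↦ f x - k x) 2 μ := by
  rw [show eLpNorm (fun x ↦ f x - g x) 2 μ = eLpNorm (fun x ↦ g x - f x) 2 μ from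
    eLpNorm_sub_comm f g 2 μ]
  refine le_trans (le_of_eq ?_) (eLpNorm_add_le (hg.sub hf) (hf.sub hk) one_le_two)
  congr 1
  ext x
  simp

/-- If two sequences converge in `L²` and have the same distances from `k` and `l`, respectively,
then so have their limits. -/
lemma eLpNorm_sub_eq_of_tendsto {α β : Type*} {m : MeasurableSpace α} {m' : MeasurableSpace β}
    {μ : Measure α} {ν : Measure β} {f k : α → ℝ} {g : ℕ → α → ℝ} {f' k' : β → ℝ}
    {g' : ℕ → β → ℝ} (hf : AEStronglyMeasurable f μ) (hk : AEStronglyMeasurable k μ)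
    (hg : ∀ j, AEStronglyMeasurable (g j) μ) (hf' : AEStronglyMeasurable f' ν)
    (hk' : AEStronglyMeasurable k' ν) (hg' : ∀ j, AEStronglyMeasurable (g' j) ν)
    (h : Tendsto (fun j ↦ eLpNorm (fun x ↦ f x - g j x) 2 μ) atTop (𝓝 0))
    (h' : Tendsto (fun j ↦ eLpNorm (fun x ↦ f' x - g' j x) 2 ν) atTop (𝓝 0))
    (e : ∀ j, eLpNorm (fun x ↦ g j x - k x) 2 μ = eLpNorm (fun x ↦ g' j x - k' x) 2 ν) :
    eLpNorm (fun x ↦ f x - k x) 2 μ = eLpNorm (fun x ↦ f' x - k' x) 2 ν := by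
  apply le_antisymm
  · exact eLpNorm_sub_le_add_of_tendsto hf hk hg h h' fun j ↦ (e j).trans_le (eLpNorm_sub_le_sub_add_sub hf' hk' (hg' j))
  · exact eLpNorm_sub_le_add_of_tendsto hf' hk' hg' h' h fun j ↦
      (e j).symm.trans_le (eLpNorm_sub_le_sub_add_sub hf hk (hg j))

lemma SimpleProcess.exists_mem_itoPairs [IsFiniteMeasure P] (φ : SimpleProcess 𝓕) :
    ∃ p ∈ itoPairs 𝓕 P W T, p.2 = φ.integral W T ∧
      p.1 =ᵐ[timeMeasure T P] fun q ↦ φ.val q.1.toNNReal q.2 := by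
  classical
  -- If `φ.τ i > T`, then truncation moves the left end back to `T`, where `φ.ξ i` need not be
  -- measurable. The truncated interval is empty, so zero may replace it.
  let ξ' : ℕ → Ω → ℝ := fun i ↦ if φ.τ i ≤ T then φ.ξ i else 0
  refine ⟨∑ i ∈ Finset.range φ.k, (step (min (φ.τ i) T) (min (φ.τ (i + 1)) T) (ξ' i),
    fun ω ↦ ξ' i ω * (W (min (φ.τ (i + 1)) T) ω - W (min (φ.τ i) T) ω)), ?_, ?_, ?_⟩
  · refine Submodule.sum_mem _ fun i _ ↦ Submodule.subset_span
      ⟨_, _, _, min_le_min_right T (φ.monotone_τ i.le_succ), min_le_right _ _, ?_, ?_, rfl⟩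
    · by_cases h : φ.τ i ≤ T
      · rw [min_eq_left h]
        simpa only [ξ', h, if_true] using φ.measurable_ξ i
      · simp only [ξ', h, if_false]
        exact @measurable_const ℝ Ω _ (𝓕 _) 0
    · obtain ⟨C, hC⟩ := φ.bounded_ξ
      by_cases h : φ.τ i ≤ T
      · simp only [ξ', h, if_true]
        exact MemLp.of_bound
          ((φ.measurable_ξ i).mono (𝓕.le _) le_rfl).aestronglyMeasurable C (ae_of_all _ (hC i))
      · simp only [ξ', h, if_false]
        exact MemLp.zero
  · ext ω
    rw [Prod.snd_sum, Finset.sum_apply, SimpleProcess.integral]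
    refine Finset.sum_congr rfl fun i _ ↦ ?_
    by_cases h : φ.τ i ≤ T
    · simp only [ξ', h, if_true]
    · have h1 : T ≤ φ.τ i := le_of_not_ge h
      have h2 : T ≤ φ.τ (i + 1) := h1.trans (φ.monotone_τ i.le_succ)
      simp [h1, h2]
  · have hT : ∀ᵐ q ∂timeMeasure T P, q.1 ∈ Set.Ioc 0 (T : ℝ) :=
      Measure.quasiMeasurePreserving_fst.ae (ae_restrict_mem measurableSet_Ioc)
    filter_upwards [hT] with q hq
    rw [Prod.fst_sum, Finset.sum_apply, SimpleProcess.val]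
    refine Finset.sum_congr rfl fun i _ ↦ ?_
    have hmem : q.1.toNNReal ∈ Set.Ioc (φ.τ i) (φ.τ (i + 1)) ↔
        (φ.τ i : ℝ) < q.1 ∧ q.1 ≤ φ.τ (i + 1) := by
      rw [Set.mem_Ioc, Real.lt_toNNReal_iff_coe_lt, Real.toNNReal_le_iff_le_coe]
    simp only [step, Set.indicator_apply, hmem, Set.mem_Ioc, NNReal.coe_min]
    by_cases h : φ.τ i ≤ T
    · have h' : (φ.τ i : ℝ) ≤ T := by exact_mod_cast h
      simp only [ξ', h, if_true, min_eq_left h', le_min_iff, hq.2, and_true]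
      split_ifs <;> simp
    · have h' : ¬ (φ.τ i : ℝ) < q.1 := fun h2 ↦ h (by exact_mod_cast (h2.le.trans hq.2))
      simp [ξ', h, h']

/-- The Itô isometry, for the distance of an Itô integral from an elementary one. -/
theorem IsItoIntegral.eLpNorm_sub [IsFiniteMeasure P] (hW : IsWiener 𝓕 P W) {f : ℝ≥0 → Ω → ℝ}
    {J : Ω → ℝ} (hJ : IsItoIntegral 𝓕 P W T f J) {p : (ℝ × Ω → ℝ) × (Ω → ℝ)}
    (hp : p ∈ itoPairs 𝓕 P W T) :
    eLpNorm (fun ω ↦ J ω - p.2 ω) 2 P =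
      eLpNorm (fun q ↦ f q.1.toNNReal q.2 - p.1 q) 2 (timeMeasure T P) := by
  obtain ⟨hf, hJ2, φ, hφ, hφJ⟩ := hJ
  choose r hr hr2 hr1 using fun m ↦ (φ m).exists_mem_itoPairs (P := P) (W := W) (T := T)
  have hp2 := memLp_of_mem_itoPairs hW hp
  have hrm := fun m ↦ memLp_of_mem_itoPairs hW (hr m)
  have h1 : Tendsto (fun m ↦ eLpNorm (fun ω ↦ J ω - (r m).2 ω) 2 P) atTop (𝓝 0) := by
    simpa only [hr2] using hφJ
  have h2 : Tendsto (fun m ↦ eLpNorm (fun q ↦ f q.1.toNNReal q.2 - (r m).1 q) 2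
      (timeMeasure T P)) atTop (𝓝 0) := by
    refine hφ.congr fun m ↦ eLpNorm_congr_ae ?_
    filter_upwards [hr1 m] with q hq
    rw [hq]
  have h3 (m : ℕ) : eLpNorm (fun ω ↦ (r m).2 ω - p.2 ω) 2 P =
      eLpNorm (fun q ↦ (r m).1 q - p.1 q) 2 (timeMeasure T P) := by
    have := eLpNorm_of_mem_itoPairs hW (Submodule.sub_mem _ (hr m) hp)
    rw [Prod.snd_sub, Prod.fst_sub] at this
    exact this
  exact eLpNorm_sub_eq_of_tendsto (μ := P) (ν := timeMeasure T P) hJ2.1 hp2.2.1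
    (fun m ↦ (hrm m).2.1) hf.1 hp2.1.1 (fun m ↦ (hrm m).1.1) h1 h2 h3

theorem IsItoIntegral.eLpNorm_eq [IsFiniteMeasure P] (hW : IsWiener 𝓕 P W) {f : ℝ≥0 → Ω → ℝ}
    {J : Ω → ℝ} (hJ : IsItoIntegral 𝓕 P W T f J) :
    eLpNorm J 2 P = eLpNorm (fun q : ℝ × Ω ↦ f q.1.toNNReal q.2) 2 (timeMeasure T P) := by
  simpa using hJ.eLpNorm_sub hW (Submodule.zero_mem _)

/-- A square integrable process that can be approximated by simple processes has an Itô
integral. -/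
theorem exists_isItoIntegral [IsFiniteMeasure P] (hW : IsWiener 𝓕 P W) {f : ℝ≥0 → Ω → ℝ}
    (hf : MemLp (fun q : ℝ × Ω ↦ f q.1.toNNReal q.2) 2 (timeMeasure T P))
    (happrox : ∀ ε : ℝ≥0∞, ε ≠ 0 → ∃ φ : SimpleProcess 𝓕,
      eLpNorm (fun q : ℝ × Ω ↦ f q.1.toNNReal q.2 - φ.val q.1.toNNReal q.2) 2
        (timeMeasure T P) ≤ ε) :
    ∃ J, IsItoIntegral 𝓕 P W T f J := by
  have hε (m : ℕ) : ((1 : ℝ≥0∞) / 4) ^ m ≠ 0 := by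
    apply pow_ne_zero
    simp
  choose φ hφ using fun m ↦ happrox _ (hε m)
  choose r hr hr2 hr1 using fun m ↦ (φ m).exists_mem_itoPairs (P := P) (W := W) (T := T)
  have hrm := fun m ↦ memLp_of_mem_itoPairs hW (hr m)
  have hfr (m : ℕ) : eLpNorm (fun q : ℝ × Ω ↦ f q.1.toNNReal q.2 - (r m).1 q) 2
      (timeMeasure T P) ≤ (1 / 4) ^ m := by
    refine (eLpNorm_congr_ae ?_).trans_le (hφ m)
    filter_upwards [hr1 m] with q hq
    rw [hq]
  have hlt : (1 : ℝ≥0∞) / 4 < 1 := by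
    rw [one_div]; exact ENNReal.inv_lt_one.2 (by norm_num)
  -- The triangle inequality bounds the distances by twice the power; the factor three supplies the
  -- strict inequality that the Cauchy criterion asks for.
  have hsum : ∑' m : ℕ, 3 * ((1 : ℝ≥0∞) / 4) ^ m ≠ ∞ := by
    rw [ENNReal.tsum_mul_left, ENNReal.tsum_geometric]
    refine ENNReal.mul_ne_top (by simp) (ENNReal.inv_ne_top.2 ?_)
    exact (tsub_pos_of_lt hlt).ne'
  have hanti {K m : ℕ} (h : K ≤ m) : ((1 : ℝ≥0∞) / 4) ^ m ≤ (1 / 4) ^ K :=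
    pow_le_pow_right_of_le_one' hlt.le h
  obtain ⟨J, hJ2, hJ⟩ := Lp.cauchy_complete_eLpNorm (p := 2) one_le_two (fun m ↦ (hrm m).2) hsum
    fun K n m hn hm ↦ by
      have e := eLpNorm_of_mem_itoPairs hW (Submodule.sub_mem _ (hr n) (hr m))
      rw [Prod.snd_sub] at e
      rw [e]
      have tri := eLpNorm_sub_le (hf.1.sub (hrm m).1.1) (hf.1.sub (hrm n).1.1) one_le_two
      have e2 : (((fun q : ℝ × Ω ↦ f q.1.toNNReal q.2) - (r m).1) -
          ((fun q : ℝ × Ω ↦ f q.1.toNNReal q.2) - (r n).1)) = (r n - r m).1 := by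
        rw [Prod.fst_sub]; abel
      rw [e2] at tri
      refine (tri.trans (add_le_add ((hfr m).trans (hanti hm)) ((hfr n).trans (hanti hn)))).trans_lt ?_
      rw [← two_mul]
      refine (ENNReal.mul_lt_mul_iff_left (hε K) ?_).2 (by norm_num)
      exact ENNReal.pow_ne_top (by simp)
  refine ⟨J, hf, hJ2, φ, ?_, ?_⟩
  · exact tendsto_of_tendsto_of_tendsto_of_le_of_le tendsto_const_nhds
      (ENNReal.tendsto_pow_atTop_nhds_zero_of_lt_one hlt) (fun _ ↦ zero_le) hφ
  · refine hJ.congr fun m ↦ ?_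
    rw [eLpNorm_sub_comm, hr2]
    rfl

end Ito

/-! ### The Itô integral of the Poisson process -/

section PoissonIntegral

variable {𝓕 : Filtration ℝ≥0 mΩ} {P : Measure Ω} {W N : ℝ≥0 → Ω → ℝ} {T lam : ℝ≥0}

lemma eLpNorm_two_sq_eq {α : Type*} {m : MeasurableSpace α} {μ : Measure α} {f : α → ℝ}
    (hf : MemLp f 2 μ) : eLpNorm f 2 μ ^ 2 = ENNReal.ofReal (∫ x, f x ^ 2 ∂μ) := by
  rw [eLpNorm_two_eq hf, ← ENNReal.ofReal_pow (Real.sqrt_nonneg _),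
    Real.sq_sqrt (integral_nonneg fun x ↦ sq_nonneg _)]

/-- The discretised times lie to the right of `r`, so right-continuity of the paths suffices for
convergence; for fixed `k` they take countably many values, which makes the discretised process
jointly measurable. -/
lemma tendsto_floor_add_one_div (r : ℝ≥0) :
    Tendsto (fun k : ℕ ↦ ((⌊r * (k + 1)⌋₊ + 1 : ℝ≥0) / (k + 1))) atTop (𝓝[≥] r) := by
  have hlt (k : ℕ) : r < (⌊r * (k + 1)⌋₊ + 1 : ℝ≥0) / (k + 1) := by
    rw [lt_div_iff₀ (by positivity)]
    exact Nat.lt_floor_add_one _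
  have hle (k : ℕ) : (⌊r * (k + 1)⌋₊ + 1 : ℝ≥0) / (k + 1) ≤ r + 1 / (k + 1) := by
    rw [add_div]
    gcongr
    rw [div_le_iff₀ (by positivity)]
    exact Nat.floor_le (by positivity)
  have h0 : Tendsto (fun k : ℕ ↦ r + 1 / ((k : ℝ≥0) + 1)) atTop (𝓝 r) := by
    have := (tendsto_one_div_add_atTop_nhds_zero_nat (𝕜 := ℝ≥0)).const_add r
    rwa [add_zero] at this
  exact tendsto_nhdsWithin_iff.2 ⟨tendsto_of_tendsto_of_tendsto_of_le_of_le tendsto_const_nhds h0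
    (fun k ↦ (hlt k).le) hle, .of_forall fun k ↦ (hlt k).le⟩

/-- The Poisson process is jointly measurable, up to null sets. -/
lemma IsPoisson.aestronglyMeasurable [SFinite P] (hN : IsPoisson 𝓕 P lam N) :
    AEStronglyMeasurable (fun q : ℝ × Ω ↦ N q.1.toNNReal q.2) (timeMeasure T P) := by
  refine aestronglyMeasurable_of_tendsto_ae atTop
    (f := fun (k : ℕ) (q : ℝ × Ω) ↦
      N ((⌊q.1.toNNReal * ((k : ℝ≥0) + 1)⌋₊ + 1 : ℝ≥0) / (k + 1)) q.2) (fun k ↦ ?_) ?_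
  · have h1 : Measurable fun x : Ω × ℕ ↦ N (((x.2 : ℝ≥0) + 1) / (k + 1)) x.1 :=
      measurable_from_prod_countable_left fun j ↦ hN.measurable (((j : ℝ≥0) + 1) / (k + 1))
    have h2 : Measurable fun q : ℝ × Ω ↦ (q.2, ⌊q.1.toNNReal * ((k : ℝ≥0) + 1)⌋₊) := by fun_prop
    exact (h1.comp h2).aestronglyMeasurable
  · have h : ∀ᵐ q ∂timeMeasure T P, ∀ t : ℝ≥0,
        ContinuousWithinAt (fun r ↦ N r q.2) (Set.Ici t) t ∧
          ∃ l : ℝ, Tendsto (fun r ↦ N r q.2) (𝓝[<] t) (𝓝 l) :=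
      Measure.quasiMeasurePreserving_snd.ae hN.cadlag
    filter_upwards [h] with q hq
    exact (hq q.1.toNNReal).1.tendsto.comp (tendsto_floor_add_one_div _)

lemma IsPoisson.eLpNorm_increment_sq (hN : IsPoisson 𝓕 P lam N) {s t : ℝ≥0} (h : s ≤ t) :
    eLpNorm (fun ω ↦ N t ω - N s ω) 2 P ^ 2 =
      ENNReal.ofReal (lam * (t - s) + (lam * (t - s)) ^ 2) := by
  rw [eLpNorm_two_sq_eq (hN.memLp_increment h), hN.integral_increment_sq h]

lemma IsPoisson.eLpNorm_sq (hN : IsPoisson 𝓕 P lam N) (t : ℝ≥0) :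
    eLpNorm (N t) 2 P ^ 2 = ENNReal.ofReal (lam * t + (lam * t) ^ 2) := by
  rw [eLpNorm_two_sq_eq (hN.memLp t), hN.integral_sq]

lemma IsPoisson.eLpNorm_timeMeasure_sq [SFinite P] (hN : IsPoisson 𝓕 P lam N) :
    eLpNorm (fun q : ℝ × Ω ↦ N q.1.toNNReal q.2) 2 (timeMeasure T P) ^ 2 =
      ENNReal.ofReal (lam * T ^ 2 / 2 + lam ^ 2 * T ^ 3 / 3) := by
  rw [LevyArea.eLpNorm_timeMeasure_sq hN.aestronglyMeasurable]
  have e : ∀ t ∈ Set.Ioc 0 (T : ℝ), eLpNorm (fun ω ↦ N t.toNNReal ω) 2 P ^ 2 =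
      ENNReal.ofReal (lam * t + (lam * t) ^ 2) := fun t ht ↦ by
    rw [hN.eLpNorm_sq, Real.coe_toNNReal t ht.1.le]
  rw [setLIntegral_congr_fun measurableSet_Ioc e,
    ← ofReal_integral_eq_lintegral_ofReal]
  · congr 1
    rw [← intervalIntegral.integral_of_le T.coe_nonneg]
    simp only [mul_pow]
    rw [intervalIntegral.integral_add (Continuous.intervalIntegrable (by fun_prop) _ _)
      (Continuous.intervalIntegrable (by fun_prop) _ _), intervalIntegral.integral_const_mul,
      intervalIntegral.integral_const_mul, integral_id, integral_pow]
    norm_num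
    ring
  · exact (Continuous.integrableOn_Icc (by fun_prop)).mono_set Set.Ioc_subset_Icc_self
  · filter_upwards [ae_restrict_mem measurableSet_Ioc] with t ht
    have := ht.1.le
    positivity

lemma IsPoisson.memLp_timeMeasure [SFinite P] (hN : IsPoisson 𝓕 P lam N) :
    MemLp (fun q : ℝ × Ω ↦ N q.1.toNNReal q.2) 2 (timeMeasure T P) := by
  refine ⟨hN.aestronglyMeasurable, ?_⟩
  have h := hN.eLpNorm_timeMeasure_sq (T := T)
  by_contra hlt
  rw [not_lt_top_iff.1 hlt] at h
  simp at h

/-- The Riemann sum of the integral of `N` with respect to `W` over the grid `s`. -/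
def riemannSum (N W : ℝ≥0 → Ω → ℝ) (s : ℕ → ℝ≥0) (m : ℕ) (ω : Ω) : ℝ :=
  ∑ p ∈ Finset.range m, N (s p) ω * (W (s (p + 1)) ω - W (s p) ω)

/-- The step process with the values of `N` at the left ends of the intervals of the grid `s`. -/
noncomputable def gridProcess (N : ℝ≥0 → Ω → ℝ) (s : ℕ → ℝ≥0) (m : ℕ) (q : ℝ × Ω) : ℝ :=
  ∑ p ∈ Finset.range m, step (s p) (s (p + 1)) (N (s p)) q

/-- `s 0, ..., s m` is a grid of `[0, T]` with gaps at most `δ`. -/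
structure IsGrid (T : ℝ≥0) (s : ℕ → ℝ≥0) (m : ℕ) (δ : ℝ) : Prop where
  monotone : Monotone s
  first : s 0 = 0
  last : s m = T
  gap_le : ∀ p, (s (p + 1) : ℝ) - s p ≤ δ

variable {s : ℕ → ℝ≥0} {m : ℕ} {δ : ℝ}

lemma gridPair_mem_itoPairs (hN : IsPoisson 𝓕 P lam N) (hs : IsGrid T s m δ) :
    (gridProcess N s m, riemannSum N W s m) ∈ itoPairs 𝓕 P W T := by
  have : (gridProcess N s m, riemannSum N W s m) = ∑ p ∈ Finset.range m,
      (step (s p) (s (p + 1)) (N (s p)), fun ω ↦ N (s p) ω * (W (s (p + 1)) ω - W (s p) ω)) := by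
    refine Prod.ext ?_ ?_
    · ext q
      simp [gridProcess, Prod.fst_sum]
    · ext q
      simp [riemannSum, Prod.snd_sum]
  rw [this]
  refine Submodule.sum_mem _ fun p hp ↦ Submodule.subset_span
    ⟨_, _, _, hs.monotone p.le_succ, ?_, hN.adapted _, hN.memLp _, rfl⟩
  rw [← hs.last]
  exact hs.monotone (Finset.mem_range.1 hp)

lemma step_eq_of_mem {a b : ℝ≥0} (ξ : Ω → ℝ) {q : ℝ × Ω} (h : (a : ℝ) < q.1 ∧ q.1 ≤ b) :
    step a b ξ q = ξ q.2 := by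
  simp [step, h.1, h.2]

lemma step_eq_zero {a b : ℝ≥0} (ξ : Ω → ℝ) {q : ℝ × Ω} (h : ¬ ((a : ℝ) < q.1 ∧ q.1 ≤ b)) :
    step a b ξ q = 0 := by
  simp only [step, Set.indicator_apply, Set.mem_Ioc, h, if_false, zero_mul]

lemma IsGrid.exists_mem (hs : IsGrid T s m δ) {t : ℝ} (ht : t ∈ Set.Ioc 0 (T : ℝ)) :
    ∃ p < m, (s p : ℝ) < t ∧ t ≤ s (p + 1) := by
  have hex : ∃ k, t ≤ s k := ⟨m, by rw [hs.last]; exact ht.2⟩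
  classical
  have hspec := Nat.find_spec hex
  have h0 : Nat.find hex ≠ 0 := fun h ↦ by
    rw [h, hs.first] at hspec
    exact absurd ht.1 (not_lt.2 (by simpa using hspec))
  obtain ⟨p, hp⟩ := Nat.exists_eq_succ_of_ne_zero h0
  have hpm : Nat.find hex ≤ m := Nat.find_min' hex (by rw [hs.last]; exact ht.2)
  refine ⟨p, by omega, ?_, by rw [hp] at hspec; exact hspec⟩
  exact not_le.1 (Nat.find_min hex (by omega))

lemma IsGrid.gridProcess_eq (hs : IsGrid T s m δ) {p : ℕ} (hp : p < m) {t : ℝ}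
    (h : (s p : ℝ) < t ∧ t ≤ s (p + 1)) (ω : Ω) : gridProcess N s m (t, ω) = N (s p) ω := by
  rw [gridProcess, Finset.sum_eq_single_of_mem p (Finset.mem_range.2 hp), step_eq_of_mem _ h]
  intro r _ hr
  refine step_eq_zero _ fun h2 ↦ ?_
  rcases lt_or_gt_of_ne hr with hlt | hlt
  · have : (s (r + 1) : ℝ) ≤ s p := by exact_mod_cast hs.monotone hlt
    linarith [h2.2, h.1]
  · have : (s (p + 1) : ℝ) ≤ s r := by exact_mod_cast hs.monotone hlt
    linarith [h2.1, h.2]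

/-- The `L²`-distance of `N` from its grid approximation. -/
lemma eLpNorm_sub_gridProcess_sq_le [SFinite P] (hW : IsWiener 𝓕 P W) (hN : IsPoisson 𝓕 P lam N)
    (hs : IsGrid T s m δ) :
    eLpNorm (fun q : ℝ × Ω ↦ N q.1.toNNReal q.2 - gridProcess N s m q) 2 (timeMeasure T P) ^ 2 ≤
      ENNReal.ofReal (lam * δ + (lam * δ) ^ 2) * T := by
  have hmem := memLp_of_mem_itoPairs hW (gridPair_mem_itoPairs (W := W) hN hs)
  have hm : AEStronglyMeasurable (fun q : ℝ × Ω ↦ N q.1.toNNReal q.2 - gridProcess N s m q)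
    (timeMeasure T P) := hN.aestronglyMeasurable.sub hmem.1.1
  rw [LevyArea.eLpNorm_timeMeasure_sq hm]
  calc _ ≤ ∫⁻ t in Set.Ioc 0 (T : ℝ), ENNReal.ofReal (lam * δ + (lam * δ) ^ 2) := by
        refine setLIntegral_mono measurable_const fun t ht ↦ ?_
        obtain ⟨p, hp, h⟩ := hs.exists_mem ht
        have hle : s p ≤ t.toNNReal := (Real.lt_toNNReal_iff_coe_lt.2 h.1).le
        have hd : (t.toNNReal : ℝ) - s p ≤ δ := by
          rw [Real.coe_toNNReal t ht.1.le]
          linarith [hs.gap_le p, h.2]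
        have hd0 : 0 ≤ (t.toNNReal : ℝ) - s p := sub_nonneg.2 (by exact_mod_cast hle)
        simp only [hs.gridProcess_eq hp h]
        rw [hN.eLpNorm_increment_sq hle]
        gcongr
    _ = _ := by
        rw [setLIntegral_const, Real.volume_Ioc, sub_zero, ENNReal.ofReal_coe_nnreal]

/-- Dropping the indicator leaves a function of `ω` alone, and the marginal of the product measure
on `Ω` is `T • P`. The bound is crude but suffices for approximation. -/
lemma eLpNorm_step_le [IsProbabilityMeasure P] {a b : ℝ≥0} {ξ : Ω → ℝ}
    (hξ : AEStronglyMeasurable ξ P) :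
    eLpNorm (step a b ξ) 2 (timeMeasure T P) ≤ (T : ℝ≥0∞) ^ (1 / 2 : ℝ) * eLpNorm ξ 2 P := by
  have h1 : eLpNorm (step a b ξ) 2 (timeMeasure T P) ≤
      eLpNorm (fun q : ℝ × Ω ↦ ξ q.2) 2 (timeMeasure T P) := by
    refine eLpNorm_mono fun q ↦ ?_
    by_cases h : (a : ℝ) < q.1 ∧ q.1 ≤ b
    · rw [step_eq_of_mem _ h]
    · rw [step_eq_zero _ h, norm_zero]
      exact norm_nonneg _
  have h2 : (timeMeasure T P).map Prod.snd = (T : ℝ≥0∞) • P := by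
    rw [timeMeasure, Measure.map_snd_prod, Measure.restrict_apply_univ, Real.volume_Ioc, sub_zero,
      ENNReal.ofReal_coe_nnreal]
  have h3 : eLpNorm (fun q : ℝ × Ω ↦ ξ q.2) 2 (timeMeasure T P) = eLpNorm ξ 2 ((T : ℝ≥0∞) • P) := by
    rw [← h2, eLpNorm_map_measure _ measurable_snd.aemeasurable]
    · rfl
    · rw [h2]
      exact hξ.smul_measure _
  refine h1.trans (h3.trans_le ?_)
  rw [eLpNorm_smul_measure_of_ne_top (by simp)]
  simp

/-- Simple functions are bounded, and approximating in `L²` of `P.trim hm` keeps them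
`m`-measurable. This is needed because simple processes have bounded coefficients while `N` is
unbounded. -/
lemma exists_bounded_approx [IsFiniteMeasure P] {m : MeasurableSpace Ω} (hm : m ≤ mΩ) {ξ : Ω → ℝ}
    (hξ : Measurable[m] ξ) (hξ2 : MemLp ξ 2 P) {ε : ℝ≥0∞} (hε : ε ≠ 0) :
    ∃ η : Ω → ℝ, Measurable[m] η ∧ (∃ C, ∀ ω, |η ω| ≤ C) ∧ eLpNorm (ξ - η) 2 P < ε := by
  have hsm : StronglyMeasurable[m] ξ := hξ.stronglyMeasurable
  have htrim : MemLp ξ 2 (P.trim hm) := ⟨hsm.aestronglyMeasurable, by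
    rw [eLpNorm_trim hm hsm]; exact hξ2.2⟩
  obtain ⟨g, hg, -⟩ := htrim.exists_simpleFunc_eLpNorm_sub_lt (by simp) hε
  refine ⟨g, SimpleFunc.measurable g, ?_, ?_⟩
  · obtain ⟨C, hC⟩ := @SimpleFunc.exists_forall_norm_le Ω ℝ m _ g
    exact ⟨C, hC⟩
  · rwa [eLpNorm_trim hm (hsm.sub (SimpleFunc.stronglyMeasurable g))] at hg

lemma step_eq_indicator (a b : ℝ≥0) (ξ : Ω → ℝ) (q : ℝ × Ω) :
    step a b ξ q = (Set.Ioc a b).indicator (fun _ ↦ ξ q.2) q.1.toNNReal := by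
  have hmem : q.1.toNNReal ∈ Set.Ioc a b ↔ (a : ℝ) < q.1 ∧ q.1 ≤ b := by
    rw [Set.mem_Ioc, Real.lt_toNNReal_iff_coe_lt, Real.toNNReal_le_iff_le_coe]
  classical
  rw [Set.indicator_apply]
  split_ifs with h
  · exact step_eq_of_mem _ (hmem.1 h)
  · exact step_eq_zero _ fun h2 ↦ h (hmem.2 h2)

/-- The grid with `m` intervals of equal length. -/
noncomputable def uniformGrid (T : ℝ≥0) (m p : ℕ) : ℝ≥0 := (min p m : ℕ) * T / m

lemma isGrid_uniformGrid (T : ℝ≥0) {m : ℕ} (hm : 0 < m) : IsGrid T (uniformGrid T m) m (T / m) where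
  monotone p q h := by
    unfold uniformGrid
    gcongr
  first := by simp [uniformGrid]
  last := by
    have : (m : ℝ≥0) ≠ 0 := by positivity
    rw [uniformGrid, min_self]
    field_simp
  gap_le p := by
    have h : ((min (p + 1) m : ℕ) : ℝ) ≤ (min p m : ℕ) + 1 := by
      exact_mod_cast (by omega : min (p + 1) m ≤ min p m + 1)
    simp only [uniformGrid]
    push_cast at h ⊢
    rw [← sub_div]
    gcongr
    nlinarith [T.coe_nonneg]

lemma exists_gridProcess_approx [SFinite P] (hW : IsWiener 𝓕 P W) (hN : IsPoisson 𝓕 P lam N)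
    {ε : ℝ≥0∞} (hε : ε ≠ 0) : ∃ (s : ℕ → ℝ≥0) (m : ℕ) (δ : ℝ), IsGrid T s m δ ∧
      eLpNorm (fun q : ℝ × Ω ↦ N q.1.toNNReal q.2 - gridProcess N s m q) 2 (timeMeasure T P) < ε := by
  have h0 : Tendsto (fun m : ℕ ↦ (T : ℝ) / ((m + 1 : ℕ) : ℝ)) atTop (𝓝 0) :=
    (tendsto_const_div_atTop_nhds_zero_nat (T : ℝ)).comp (tendsto_add_atTop_nat 1)
  have h1 : Tendsto (fun m : ℕ ↦ ENNReal.ofReal (lam * ((T : ℝ) / ((m + 1 : ℕ) : ℝ)) +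
      (lam * ((T : ℝ) / ((m + 1 : ℕ) : ℝ))) ^ 2) * T) atTop (𝓝 0) := by
    have h := ENNReal.tendsto_ofReal ((h0.const_mul (lam : ℝ)).add
      ((h0.const_mul (lam : ℝ)).pow 2))
    have h2 := ENNReal.Tendsto.mul_const h (b := (T : ℝ≥0∞)) (Or.inr (by simp))
    simpa using h2
  obtain ⟨m, hm⟩ := (h1.eventually_lt_const (pos_iff_ne_zero.2 (pow_ne_zero 2 hε))).exists
  have hg := isGrid_uniformGrid T (Nat.succ_pos m)
  exact ⟨_, _, _, hg, lt_of_pow_lt_pow_left' 2 ((eLpNorm_sub_gridProcess_sq_le hW hN hg).trans_lt hm)⟩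

/-- Two replacements, each at a cost of at most `ε / 2`: first `N` by its values at the left ends of
a fine grid, then these values by bounded ones. -/
lemma exists_simpleProcess_approx [IsProbabilityMeasure P] (hW : IsWiener 𝓕 P W)
    (hN : IsPoisson 𝓕 P lam N) {ε : ℝ≥0∞} (hε : ε ≠ 0) :
    ∃ φ : SimpleProcess 𝓕, eLpNorm (fun q : ℝ × Ω ↦ N q.1.toNNReal q.2 -
      φ.val q.1.toNNReal q.2) 2 (timeMeasure T P) ≤ ε := by
  have hε2 : ε / 2 ≠ 0 := (ENNReal.half_pos hε).ne'
  obtain ⟨s, m, δ, hs, hsε⟩ := exists_gridProcess_approx (T := T) hW hN hε2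
  -- The tolerance for one grid value: each of the `m` intervals contributes at most `T ^ (1 / 2) *
  -- r`.
  obtain ⟨r, hr0, hr⟩ := ENNReal.exists_nnreal_pos_mul_lt
    (a := (m : ℝ≥0∞) * (T : ℝ≥0∞) ^ (1 / 2 : ℝ))
    (ENNReal.mul_ne_top (by simp) (ENNReal.rpow_ne_top_of_nonneg (by norm_num) (by simp))) hε2
  choose η hη hC hηr using fun p ↦ exists_bounded_approx (𝓕.le (s p)) (hN.adapted (s p))
    (hN.memLp (s p)) (ε := r) (by simpa using hr0.ne')
  choose C hC using hC
  let φ : SimpleProcess 𝓕 :=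
    { k := m
      τ := s
      monotone_τ := hs.monotone
      -- The zeros beyond `m` leave finitely many bounds `C p`, hence a uniform one.
      ξ := fun p ↦ if p < m then η p else 0
      measurable_ξ := fun p ↦ by
        split_ifs
        · exact hη p
        · exact @measurable_const ℝ Ω _ (𝓕 _) 0
      bounded_ξ := by
        refine ⟨∑ p ∈ Finset.range m, |C p|, fun p ω ↦ ?_⟩
        split_ifs with h
        · exact ((hC p ω).trans (le_abs_self _)).trans
            (Finset.single_le_sum (f := fun p ↦ |C p|) (fun _ _ ↦ abs_nonneg _)
              (Finset.mem_range.2 h))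
        · simpa using Finset.sum_nonneg fun p _ ↦ abs_nonneg (C p) }
  have hval (q : ℝ × Ω) : gridProcess N s m q - φ.val q.1.toNNReal q.2 =
      (∑ p ∈ Finset.range m, step (s p) (s (p + 1)) (N (s p) - η p)) q := by
    rw [gridProcess, SimpleProcess.val, Finset.sum_apply, ← Finset.sum_sub_distrib]
    refine Finset.sum_congr rfl fun p hp ↦ ?_
    rw [← step_eq_indicator (s p) (s (p + 1)) (φ.ξ p) q]
    have : φ.ξ p = η p := by simp [φ, Finset.mem_range.1 hp]
    rw [this]
    simp only [step, Pi.sub_apply]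
    ring
  have hηm (p : ℕ) : AEStronglyMeasurable (N (s p) - η p) P :=
    ((hN.measurable _).sub ((hη p).mono (𝓕.le _) le_rfl)).aestronglyMeasurable
  have hstep (p : ℕ) : AEStronglyMeasurable (step (s p) (s (p + 1)) (N (s p) - η p))
      (timeMeasure T P) := by
    have h1 : AEStronglyMeasurable ((Set.Ioc (s p : ℝ) (s (p + 1))).indicator (1 : ℝ → ℝ))
      ((volume : Measure ℝ).restrict (Set.Ioc 0 (T : ℝ))) :=
      (stronglyMeasurable_one.indicator measurableSet_Ioc).aestronglyMeasurable
    exact h1.comp_fst.mul (hηm p).comp_snd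
  refine ⟨φ, ?_⟩
  have hmem := memLp_of_mem_itoPairs hW (gridPair_mem_itoPairs (W := W) hN hs)
  have hsum : eLpNorm (∑ p ∈ Finset.range m, step (s p) (s (p + 1)) (N (s p) - η p)) 2
      (timeMeasure T P) ≤ ε / 2 := by
    refine (eLpNorm_sum_le (fun p _ ↦ hstep p) one_le_two).trans ?_
    refine (Finset.sum_le_sum fun p _ ↦ (eLpNorm_step_le (hηm p)).trans
      (mul_le_mul_right (hηr p).le _)).trans ?_
    rw [Finset.sum_const, Finset.card_range, nsmul_eq_mul, ← mul_assoc, mul_comm]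
    exact hr.le
  have hsplit : (fun q : ℝ × Ω ↦ N q.1.toNNReal q.2 - φ.val q.1.toNNReal q.2) =
      (fun q : ℝ × Ω ↦ N q.1.toNNReal q.2 - gridProcess N s m q) +
        ∑ p ∈ Finset.range m, step (s p) (s (p + 1)) (N (s p) - η p) := by
    ext q
    rw [Pi.add_apply, ← hval]
    ring
  rw [hsplit]
  have hm : AEStronglyMeasurable (fun q : ℝ × Ω ↦ N q.1.toNNReal q.2 - gridProcess N s m q)
    (timeMeasure T P) := hN.aestronglyMeasurable.sub hmem.1.1
  refine (eLpNorm_add_le hm (Finset.aestronglyMeasurable_sum _ fun p _ ↦ hstep p)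
    one_le_two).trans ?_
  exact (add_le_add hsε.le hsum).trans_eq (ENNReal.add_halves ε)

/-- The Itô integral of the Poisson process exists. -/
theorem IsPoisson.exists_isItoIntegral [IsProbabilityMeasure P] (hW : IsWiener 𝓕 P W)
    (hN : IsPoisson 𝓕 P lam N) : ∃ J, IsItoIntegral 𝓕 P W T N J :=
  LevyArea.exists_isItoIntegral hW hN.memLp_timeMeasure fun _ hε ↦
    exists_simpleProcess_approx hW hN hε

/-- The Itô integral of `N` is the limit of its Riemann sums. -/
lemma IsItoIntegral.eLpNorm_sub_riemannSum_sq_le [IsProbabilityMeasure P] (hW : IsWiener 𝓕 P W)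
    (hN : IsPoisson 𝓕 P lam N) {J : Ω → ℝ} (hJ : IsItoIntegral 𝓕 P W T N J)
    (hs : IsGrid T s m δ) :
    eLpNorm (fun ω ↦ J ω - riemannSum N W s m ω) 2 P ^ 2 ≤
      ENNReal.ofReal (lam * δ + (lam * δ) ^ 2) * T := by
  have := hJ.eLpNorm_sub hW (gridPair_mem_itoPairs hN hs)
  simp only at this
  rw [this]
  exact eLpNorm_sub_gridProcess_sq_le hW hN hs

lemma IsItoIntegral.integral_sq [IsProbabilityMeasure P] (hW : IsWiener 𝓕 P W)
    (hN : IsPoisson 𝓕 P lam N) {J : Ω → ℝ} (hJ : IsItoIntegral 𝓕 P W T N J) :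
    ∫ ω, J ω ^ 2 ∂P = lam * T ^ 2 / 2 + lam ^ 2 * T ^ 3 / 3 := by
  have h := eLpNorm_two_sq_eq hJ.2.1
  rw [hJ.eLpNorm_eq hW, hN.eLpNorm_timeMeasure_sq] at h
  exact ((ENNReal.ofReal_eq_ofReal_iff (by positivity)
    (integral_nonneg fun ω ↦ sq_nonneg _)).1 h).symm

end PoissonIntegral

/-! ### Refinements of a mesh -/

section Mesh

variable {T : ℝ≥0} {n : ℕ} {t : Fin (n + 1) → ℝ≥0}

/-- The nodes of a mesh, as a sequence that is constant after the last node. -/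
def meshExt {n : ℕ} (t : Fin (n + 1) → ℝ≥0) (i : ℕ) : ℝ≥0 := t ⟨min i n, by omega⟩

lemma meshExt_castSucc (t : Fin (n + 1) → ℝ≥0) (i : Fin n) : meshExt t i = t i.castSucc := by
  unfold meshExt
  congr 1
  ext
  simp [i.2.le]

lemma meshExt_succ (t : Fin (n + 1) → ℝ≥0) (i : Fin n) : meshExt t (i + 1) = t i.succ := by
  unfold meshExt
  congr 1
  ext
  simp [i.2]

lemma IsMesh.monotone_meshExt (ht : IsMesh T n t) : Monotone (meshExt t) := fun i j h ↦
  ht.strictMono.monotone (by simpa [Fin.le_def] using by omega)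

lemma IsMesh.meshExt_zero (ht : IsMesh T n t) : meshExt t 0 = 0 := by
  rw [← ht.first]
  rfl

lemma IsMesh.meshExt_last (ht : IsMesh T n t) : meshExt t n = T := by
  rw [← ht.last]
  unfold meshExt
  congr 1
  ext
  simp

lemma IsMesh.meshExt_le (ht : IsMesh T n t) (i : ℕ) : meshExt t i ≤ T := by
  rw [← ht.last]
  exact ht.strictMono.monotone (Fin.le_last _)

/-- The grid obtained by dividing each interval of a mesh into `k` intervals of equal length. -/
noncomputable def refinedMesh {n : ℕ} (t : Fin (n + 1) → ℝ≥0) (k p : ℕ) : ℝ≥0 :=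
  ∑ q ∈ Finset.range p, (meshExt t (q / k + 1) - meshExt t (q / k)) / k

lemma refinedMesh_succ (t : Fin (n + 1) → ℝ≥0) (k p : ℕ) : refinedMesh t k (p + 1) =
    refinedMesh t k p + (meshExt t (p / k + 1) - meshExt t (p / k)) / k :=
  Finset.sum_range_succ _ _

/-- The gap depends on `p` only through the block `p / k`, so permutations inside a block preserve
interval lengths. -/
lemma refinedMesh_succ_sub (t : Fin (n + 1) → ℝ≥0) (k p : ℕ) :
    refinedMesh t k (p + 1) - refinedMesh t k p =
      (meshExt t (p / k + 1) - meshExt t (p / k)) / k := by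
  rw [refinedMesh_succ, add_tsub_cancel_left]

lemma IsMesh.refinedMesh_mul (ht : IsMesh T n t) {k : ℕ} (hk : 0 < k) (i : ℕ) :
    refinedMesh t k (i * k) = meshExt t i := by
  induction i with
  | zero => simp [refinedMesh, ht.meshExt_zero]
  | succ i ih =>
    have hk' : (k : ℝ≥0) ≠ 0 := by positivity
    rw [refinedMesh, Nat.succ_mul, Finset.sum_range_add, ← refinedMesh, ih]
    have (j : ℕ) (hj : j ∈ Finset.range k) : (i * k + j) / k = i := by
      rw [mul_comm, Nat.mul_add_div hk, Nat.div_eq_of_lt (Finset.mem_range.1 hj), add_zero]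
    rw [Finset.sum_congr rfl fun j hj ↦ by rw [this j hj], Finset.sum_const, Finset.card_range,
      nsmul_eq_mul, mul_div_cancel₀ _ hk', add_tsub_cancel_of_le (ht.monotone_meshExt i.le_succ)]

lemma IsMesh.isGrid_refinedMesh (ht : IsMesh T n t) {k : ℕ} (hk : 0 < k) :
    IsGrid T (refinedMesh t k) (n * k) (T / k) where
  monotone := monotone_nat_of_le_succ fun p ↦ by
    rw [refinedMesh_succ]
    exact le_self_add
  first := by simp [refinedMesh]
  last := by rw [ht.refinedMesh_mul hk, ht.meshExt_last]
  gap_le p := by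
    rw [refinedMesh_succ]
    push_cast
    rw [add_sub_cancel_left]
    gcongr
    exact tsub_le_self.trans (ht.meshExt_le _)

end Mesh

/-! ### The conditional expectation of the Itô integral -/

section CondExp

variable {𝓕 : Filtration ℝ≥0 mΩ} {P : Measure Ω} {W N : ℝ≥0 → Ω → ℝ} {T lam : ℝ≥0} {n : ℕ}
  {t : Fin (n + 1) → ℝ≥0}

/-- The sums of the coordinates of a vector over the first blocks of length `k`. -/
def blockSums (n k : ℕ) (x : Fin (n * k) → ℝ) (i : Fin n) : ℝ :=
  ∑ p : Fin (n * k), if (p : ℕ) / k ≤ i then x p else 0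

lemma measurable_blockSums (n k : ℕ) : Measurable (blockSums n k) :=
  measurable_pi_lambda _ fun i ↦ Finset.measurable_sum _ fun p _ ↦ by
    split_ifs <;> fun_prop

/-- Sums over whole blocks do not see rearrangements within a block. The node values are such sums,
hence so is the information. -/
lemma blockSums_comp_perm {k : ℕ} {σ : Equiv.Perm (Fin (n * k))}
    (hσ : ∀ p, (σ p : ℕ) / k = p / k) (x : Fin (n * k) → ℝ) :
    blockSums n k (x ∘ σ) = blockSums n k x := by
  ext i
  rw [blockSums, blockSums,
    ← Equiv.sum_comp σ fun p : Fin (n * k) ↦ if (p : ℕ) / k ≤ i then x p else 0]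
  simp [hσ]

lemma swap_div_eq {m k : ℕ} {p q : Fin m} (h : (p : ℕ) / k = q / k) (r : Fin m) :
    (Equiv.swap p q r : ℕ) / k = r / k := by
  rw [Equiv.swap_apply_def]
  split_ifs with h1 h2
  · rw [h1, h]
  · rw [h2, h]
  · rfl

lemma blockSums_increments (ht : IsMesh T n t) {k : ℕ} (hk : 0 < k) {X : ℝ≥0 → Ω → ℝ} {ω : Ω}
    (h0 : X 0 ω = 0) (i : Fin n) :
    blockSums n k (increments X (refinedMesh t k) (n * k) ω) i = X (t i.succ) ω := by
  have h1 : (i + 1 : ℕ) * k ≤ n * k := Nat.mul_le_mul_right k i.2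
  have e : (Finset.range (n * k)).filter (fun p ↦ p / k ≤ i) = Finset.range ((i + 1 : ℕ) * k) := by
    ext p
    rw [Finset.mem_filter, Finset.mem_range, Finset.mem_range, ← Nat.lt_succ_iff,
      Nat.div_lt_iff_lt_mul hk]
    constructor
    · exact fun h ↦ h.2
    · exact fun h ↦ ⟨h.trans_le h1, h⟩
  unfold blockSums increments
  rw [Finset.sum_fin_eq_sum_range, ← meshExt_succ t i, ← ht.refinedMesh_mul hk]
  calc _ = ∑ p ∈ Finset.range (n * k), if p / k ≤ i then
        X (refinedMesh t k (p + 1)) ω - X (refinedMesh t k p) ω else 0 :=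
        Finset.sum_congr rfl fun p hp ↦ by rw [dif_pos (Finset.mem_range.1 hp)]
    _ = ∑ p ∈ Finset.range ((i + 1 : ℕ) * k),
        (X (refinedMesh t k (p + 1)) ω - X (refinedMesh t k p) ω) := by
        rw [← Finset.sum_filter, e]
    _ = _ := by
        rw [Finset.sum_range_sub fun p ↦ X (refinedMesh t k p) ω]
        simp [refinedMesh, h0]

lemma IsWiener.zero (hW : IsWiener 𝓕 P W) : ∀ᵐ ω ∂P, W 0 ω = 0 :=
  hW.isBrownian.eval_zero_ae_eq_zero

lemma measurable_info {n : ℕ} (hW : IsWiener 𝓕 P W) (hN : IsPoisson 𝓕 P lam N)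
    (t : Fin (n + 1) → ℝ≥0) : Measurable (info N W t) :=
  (measurable_pi_lambda _ fun _ ↦ hN.measurable _).prodMk
    (measurable_pi_lambda _ fun _ ↦ hW.measurable _)

lemma info_ae_eq_blockSums (hW : IsWiener 𝓕 P W) (hN : IsPoisson 𝓕 P lam N) (ht : IsMesh T n t)
    {k : ℕ} (hk : 0 < k) : ∀ᵐ ω ∂P, info N W t ω =
      (blockSums n k (increments N (refinedMesh t k) (n * k) ω),
        blockSums n k (increments W (refinedMesh t k) (n * k) ω)) := by
  filter_upwards [hW.zero, hN.zero] with ω hw hn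
  refine Prod.ext (funext fun i ↦ ?_) (funext fun i ↦ ?_)
  · exact (blockSums_increments ht hk hn i).symm
  · exact (blockSums_increments ht hk hw i).symm

variable [IsProbabilityMeasure P]

/-- On an event determined by the values at the nodes, the mixed moment of two increments over
subintervals of the same mesh interval does not depend on the choice of the subintervals. -/
lemma setIntegral_increment_mul_increment_eq (hW : IsWiener 𝓕 P W) (hN : IsPoisson 𝓕 P lam N)
    (ht : IsMesh T n t) {k : ℕ} (hk : 0 < k) {B : Set ((Fin n → ℝ) × (Fin n → ℝ))}
    (hB : MeasurableSet B) {p q p' q' : Fin (n * k)} (hp : (p : ℕ) / k = p' / k)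
    (hq : (q : ℕ) / k = q' / k) :
    ∫ ω in info N W t ⁻¹' B, increments N (refinedMesh t k) (n * k) ω p *
        increments W (refinedMesh t k) (n * k) ω q ∂P =
      ∫ ω in info N W t ⁻¹' B, increments N (refinedMesh t k) (n * k) ω p' *
        increments W (refinedMesh t k) (n * k) ω q' ∂P := by
  set s := refinedMesh t k
  set X := increments N s (n * k)
  set Y := increments W s (n * k)
  have hX : Measurable X := measurable_increments hN.measurable _ _
  have hY : Measurable Y := measurable_increments hW.measurable _ _
  let D : Set ((Fin (n * k) → ℝ) × (Fin (n * k) → ℝ)) :=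
    {z | (blockSums n k z.1, blockSums n k z.2) ∈ B}
  have hD : MeasurableSet D :=
    (((measurable_blockSums n k).comp measurable_fst).prodMk
      ((measurable_blockSums n k).comp measurable_snd)) hB
  have hS : info N W t ⁻¹' B =ᵐ[P] (fun ω ↦ (X ω, Y ω)) ⁻¹' D := by
    filter_upwards [info_ae_eq_blockSums hW hN ht hk] with ω hω
    apply propext
    change info N W t ω ∈ B ↔ _ ∈ B
    rw [hω]
  let F (p q : Fin (n * k)) : (Fin (n * k) → ℝ) × (Fin (n * k) → ℝ) → ℝ :=
    D.indicator fun z ↦ z.1 p * z.2 q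
  have hF (p q : Fin (n * k)) : Measurable (F p q) :=
    Measurable.indicator (by fun_prop) hD
  have e (p q : Fin (n * k)) : ∫ ω in info N W t ⁻¹' B, X ω p * Y ω q ∂P =
      ∫ z, F p q z ∂(P.map fun ω ↦ (X ω, Y ω)) := by
    rw [setIntegral_congr_set hS, ← integral_indicator ((hX.prodMk hY) hD),
      integral_map (hX.prodMk hY).aemeasurable (hF p q).aestronglyMeasurable]
    rfl
  rw [e, e]
  have gap {σ : Equiv.Perm (Fin (n * k))} (hσ : ∀ r, (σ r : ℕ) / k = r / k) (r : Fin (n * k)) :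
      s (σ r + 1) - s (σ r) = s (r + 1) - s r := by
    rw [refinedMesh_succ_sub, refinedMesh_succ_sub, hσ]
  -- Two separate transpositions, `p` with `p'` for `N` and `q` with `q'` for `W`. They preserve the
  -- joint law and the block sums that describe the event.
  have hσ := swap_div_eq hp
  have hτ := swap_div_eq hq
  have law := map_increments_perm hW hN (ht.isGrid_refinedMesh hk).monotone (gap hσ) (gap hτ)
  have hperm : Measurable fun ω ↦ (X ω ∘ Equiv.swap p p', Y ω ∘ Equiv.swap q q') :=
    (measurable_pi_lambda _ fun r ↦ (measurable_pi_apply _).comp hX).prodMk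
      (measurable_pi_lambda _ fun r ↦ (measurable_pi_apply _).comp hY)
  rw [← law, integral_map hperm.aemeasurable (hF p q).aestronglyMeasurable, law,
    integral_map (hX.prodMk hY).aemeasurable (hF p' q').aestronglyMeasurable]
  congr with ω
  classical
  simp only [F, Set.indicator_apply, D, Set.mem_ofPred_eq, blockSums_comp_perm hσ,
    blockSums_comp_perm hτ, Function.comp_apply, Equiv.swap_apply_left]

end CondExp

/-! ### Integrals of Riemann sums and of the trapezoidal method over events determined by the node
values. -/

section CondExp

variable {𝓕 : Filtration ℝ≥0 mΩ} {P : Measure Ω} {W N : ℝ≥0 → Ω → ℝ} {T lam : ℝ≥0} {n : ℕ}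
  {t : Fin (n + 1) → ℝ≥0}

lemma sum_range_mul_eq {M : Type*} [AddCommMonoid M] (f : ℕ → M) (n k : ℕ) :
    ∑ p ∈ Finset.range (n * k), f p =
      ∑ i ∈ Finset.range n, ∑ j ∈ Finset.range k, f (i * k + j) := by
  induction n with
  | zero => simp
  | succ n ih => rw [Nat.succ_mul, Finset.sum_range_add, ih, Finset.sum_range_succ]

lemma sub_eq_sum_increments {X : ℝ≥0 → Ω → ℝ} (s : ℕ → ℝ≥0) (a j : ℕ) (ω : Ω) :
    X (s (a + j)) ω - X (s a) ω =
      ∑ l ∈ Finset.range j, (X (s (a + l + 1)) ω - X (s (a + l)) ω) :=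
  (Finset.sum_range_sub (fun l ↦ X (s (a + l)) ω) j).symm

/-- The increment of `X` over an interval of a mesh is the sum of the increments over its parts. -/
lemma IsMesh.meshExt_increment (ht : IsMesh T n t) {k : ℕ} (hk : 0 < k) (X : ℝ≥0 → Ω → ℝ) (i : ℕ)
    (ω : Ω) : X (meshExt t (i + 1)) ω - X (meshExt t i) ω = ∑ j ∈ Finset.range k,
      (X (refinedMesh t k (i * k + j + 1)) ω - X (refinedMesh t k (i * k + j)) ω) := by
  rw [← ht.refinedMesh_mul hk, ← ht.refinedMesh_mul hk, Nat.succ_mul, sub_eq_sum_increments]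

/-- The value of `N` at the left end of part `j` is its value at the mesh node plus its increments
over the earlier parts `l < j` of the same mesh interval. -/
lemma IsMesh.riemannSum_refinedMesh (ht : IsMesh T n t) {k : ℕ} (hk : 0 < k) (ω : Ω) :
    riemannSum N W (refinedMesh t k) (n * k) ω = ∑ i ∈ Finset.range n,
      (N (meshExt t i) ω * (W (meshExt t (i + 1)) ω - W (meshExt t i) ω) +
        ∑ j ∈ Finset.range k, ∑ l ∈ Finset.range j,
          (N (refinedMesh t k (i * k + l + 1)) ω - N (refinedMesh t k (i * k + l)) ω) *
            (W (refinedMesh t k (i * k + j + 1)) ω - W (refinedMesh t k (i * k + j)) ω)) := by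
  rw [riemannSum, sum_range_mul_eq]
  refine Finset.sum_congr rfl fun i _ ↦ ?_
  rw [ht.meshExt_increment hk W, Finset.mul_sum, ← Finset.sum_add_distrib]
  refine Finset.sum_congr rfl fun j _ ↦ ?_
  rw [← Finset.sum_mul, ← sub_eq_sum_increments, ← add_mul, ht.refinedMesh_mul hk,
    add_sub_cancel]

lemma integrable_mul_increment (hW : IsWiener 𝓕 P W) {X : Ω → ℝ} (hX : MemLp X 2 P) {a b : ℝ≥0}
    (hab : a ≤ b) : Integrable (fun ω ↦ X ω * (W b ω - W a ω)) P :=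
  hX.integrable_mul (hW.memLp_increment (p := 2) hab (by simp))

/-- The trapezoidal method as a function of the values at the nodes. -/
noncomputable def trapezoidalFun {n : ℕ} (z : (Fin n → ℝ) × (Fin n → ℝ)) : ℝ :=
  ∑ i : Fin n, 1 / 2 * ((Fin.cons 0 z.2 : Fin (n + 1) → ℝ) i.succ -
    (Fin.cons 0 z.2 : Fin (n + 1) → ℝ) i.castSucc) *
    ((Fin.cons 0 z.1 : Fin (n + 1) → ℝ) i.succ + (Fin.cons 0 z.1 : Fin (n + 1) → ℝ) i.castSucc)

lemma measurable_trapezoidalFun {n : ℕ} : Measurable (trapezoidalFun (n := n)) := by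
  have h (i : Fin (n + 1)) : Measurable fun x : Fin n → ℝ ↦ (Fin.cons 0 x : Fin (n + 1) → ℝ) i := by
    refine Fin.cases ?_ (fun i ↦ ?_) i
    · simp only [Fin.cons_zero]; fun_prop
    · simp only [Fin.cons_succ]; fun_prop
  refine Finset.measurable_sum _ fun i _ ↦ Measurable.mul (Measurable.const_mul ?_ _) ?_
  · exact ((h _).comp measurable_snd).sub ((h _).comp measurable_snd)
  · exact ((h _).comp measurable_fst).add ((h _).comp measurable_fst)

/-- The information omits the node `0`, and the starting values vanish only almost surely; hence an
almost sure equality. -/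
lemma trapezoidal_ae_eq (hW : IsWiener 𝓕 P W) (hN : IsPoisson 𝓕 P lam N) (ht : IsMesh T n t) :
    trapezoidal N W t =ᵐ[P] fun ω ↦ trapezoidalFun (info N W t ω) := by
  filter_upwards [hW.zero, hN.zero] with ω hw hn
  have h {X : ℝ≥0 → Ω → ℝ} (hX : X 0 ω = 0) (i : Fin (n + 1)) :
      (Fin.cons 0 (fun i : Fin n ↦ X (t i.succ) ω) : Fin (n + 1) → ℝ) i = X (t i) ω := by
    refine Fin.cases ?_ (fun i ↦ ?_) i
    · rw [Fin.cons_zero, ht.first, hX]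
    · rw [Fin.cons_succ]
  simp only [trapezoidal, trapezoidalFun, info, h hw, h hn]

/-- Left-point sum plus half the products of increments: the form that can be compared with the
Riemann sums term by term. -/
lemma trapezoidal_eq (t : Fin (n + 1) → ℝ≥0) (ω : Ω) : trapezoidal N W t ω =
    ∑ i ∈ Finset.range n, (N (meshExt t i) ω * (W (meshExt t (i + 1)) ω - W (meshExt t i) ω) +
      1 / 2 * ((N (meshExt t (i + 1)) ω - N (meshExt t i) ω) *
        (W (meshExt t (i + 1)) ω - W (meshExt t i) ω))) := by
  rw [Finset.sum_range, trapezoidal]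
  refine Finset.sum_congr rfl fun i _ ↦ ?_
  rw [meshExt_castSucc, meshExt_succ]
  ring

lemma setIntegral_trapezoidal (hW : IsWiener 𝓕 P W) (hN : IsPoisson 𝓕 P lam N)
    (ht : IsMesh T n t) (S : Set Ω) :
    ∫ ω in S, trapezoidal N W t ω ∂P = ∑ i ∈ Finset.range n,
      (∫ ω in S, N (meshExt t i) ω * (W (meshExt t (i + 1)) ω - W (meshExt t i) ω) ∂P +
        1 / 2 * ∫ ω in S, (N (meshExt t (i + 1)) ω - N (meshExt t i) ω) *
          (W (meshExt t (i + 1)) ω - W (meshExt t i) ω) ∂P) := by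
  have hi (i : ℕ) := ht.monotone_meshExt i.le_succ
  have i1 (i : ℕ) : IntegrableOn (fun ω ↦ N (meshExt t i) ω *
      (W (meshExt t (i + 1)) ω - W (meshExt t i) ω)) S P :=
    (integrable_mul_increment hW (hN.memLp _) (hi i)).integrableOn
  have i2 (i : ℕ) : IntegrableOn (fun ω ↦ 1 / 2 * ((N (meshExt t (i + 1)) ω - N (meshExt t i) ω) *
      (W (meshExt t (i + 1)) ω - W (meshExt t i) ω))) S P :=
    ((integrable_mul_increment hW (hN.memLp_increment (hi i)) (hi i)).const_mul _).integrableOn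
  simp only [trapezoidal_eq]
  refine (integral_finsetSum _ fun i _ ↦ (i1 i).add (i2 i)).trans ?_
  refine Finset.sum_congr rfl fun i _ ↦ ?_
  simp only [Pi.add_apply]
  rw [integral_add (i1 i) (i2 i), integral_const_mul]

variable [IsProbabilityMeasure P]

/-- The `k ^ 2` mixed moments within a mesh interval are equal by exchangeability, and they add up
to the mixed moment over the whole interval. -/
lemma setIntegral_refined_increments (hW : IsWiener 𝓕 P W) (hN : IsPoisson 𝓕 P lam N)
    (ht : IsMesh T n t) {k : ℕ} {B : Set ((Fin n → ℝ) × (Fin n → ℝ))}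
    (hB : MeasurableSet B) {i l j : ℕ} (hi : i < n) (hl : l < k) (hj : j < k) :
    ∫ ω in info N W t ⁻¹' B,
        (N (refinedMesh t k (i * k + l + 1)) ω - N (refinedMesh t k (i * k + l)) ω) *
          (W (refinedMesh t k (i * k + j + 1)) ω - W (refinedMesh t k (i * k + j)) ω) ∂P =
      (∫ ω in info N W t ⁻¹' B, (N (meshExt t (i + 1)) ω - N (meshExt t i) ω) *
          (W (meshExt t (i + 1)) ω - W (meshExt t i) ω) ∂P) / k ^ 2 := by
  have hk : 0 < k := by omega
  have hmono := (ht.isGrid_refinedMesh hk).monotone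
  have lt {j : ℕ} (hj : j < k) : i * k + j < n * k := by
    calc i * k + j < i * k + k := by omega
      _ = (i + 1) * k := by ring
      _ ≤ n * k := Nat.mul_le_mul_right k hi
  have hdiv {j : ℕ} (hj : j < k) : (i * k + j) / k = i := by
    rw [mul_comm, Nat.mul_add_div hk, Nat.div_eq_of_lt hj, add_zero]
  have const {l' j' : ℕ} (hl' : l' < k) (hj' : j' < k) :
      ∫ ω in info N W t ⁻¹' B,
        (N (refinedMesh t k (i * k + l' + 1)) ω - N (refinedMesh t k (i * k + l')) ω) *
          (W (refinedMesh t k (i * k + j' + 1)) ω - W (refinedMesh t k (i * k + j')) ω) ∂P =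
      ∫ ω in info N W t ⁻¹' B,
        (N (refinedMesh t k (i * k + l + 1)) ω - N (refinedMesh t k (i * k + l)) ω) *
          (W (refinedMesh t k (i * k + j + 1)) ω - W (refinedMesh t k (i * k + j)) ω) ∂P :=
    setIntegral_increment_mul_increment_eq hW hN ht hk hB (p := ⟨i * k + l', lt hl'⟩)
      (p' := ⟨i * k + l, lt hl⟩) (q := ⟨i * k + j', lt hj'⟩) (q' := ⟨i * k + j, lt hj⟩)
      (by simp only [hdiv, hl', hl]) (by simp only [hdiv, hj', hj])
  have int (l' j' : ℕ) : IntegrableOn (fun ω ↦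
      (N (refinedMesh t k (i * k + l' + 1)) ω - N (refinedMesh t k (i * k + l')) ω) *
        (W (refinedMesh t k (i * k + j' + 1)) ω - W (refinedMesh t k (i * k + j')) ω))
        (info N W t ⁻¹' B) P :=
    (integrable_mul_increment hW (hN.memLp_increment (hmono (Nat.le_succ _)))
      (hmono (Nat.le_succ _))).integrableOn
  have int2 (l' : ℕ) := integrable_finsetSum (Finset.range k) fun j' _ ↦ int l' j'
  simp only [ht.meshExt_increment hk, Finset.sum_mul_sum]
  rw [integral_finsetSum _ fun l' _ ↦ int2 l', eq_div_iff (by positivity)]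
  simp only [fun l' ↦ integral_finsetSum (Finset.range k) fun j' _ ↦ int l' j']
  rw [Finset.sum_congr rfl fun l' hl' ↦ Finset.sum_congr rfl fun j' hj' ↦
    const (Finset.mem_range.1 hl') (Finset.mem_range.1 hj')]
  simp only [Finset.sum_const, Finset.card_range, nsmul_eq_mul]
  ring

/-- Of the `k ^ 2` equal mixed moments, the Riemann sum contains the `k (k - 1) / 2` with `l < j`;
their share is `1 / 2 - 1 / 2 * (1 / k)`. -/
lemma setIntegral_riemannSum (hW : IsWiener 𝓕 P W) (hN : IsPoisson 𝓕 P lam N)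
    (ht : IsMesh T n t) {k : ℕ} (hk : 0 < k) {B : Set ((Fin n → ℝ) × (Fin n → ℝ))}
    (hB : MeasurableSet B) :
    ∫ ω in info N W t ⁻¹' B, riemannSum N W (refinedMesh t k) (n * k) ω ∂P =
      ∑ i ∈ Finset.range n,
        (∫ ω in info N W t ⁻¹' B,
          N (meshExt t i) ω * (W (meshExt t (i + 1)) ω - W (meshExt t i) ω) ∂P +
        (1 / 2 - 1 / 2 * (1 / k)) * ∫ ω in info N W t ⁻¹' B,
          (N (meshExt t (i + 1)) ω - N (meshExt t i) ω) *
            (W (meshExt t (i + 1)) ω - W (meshExt t i) ω) ∂P) := by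
  have hmono := (ht.isGrid_refinedMesh hk).monotone
  have i1 (i : ℕ) : IntegrableOn (fun ω ↦ N (meshExt t i) ω *
      (W (meshExt t (i + 1)) ω - W (meshExt t i) ω)) (info N W t ⁻¹' B) P :=
    (integrable_mul_increment hW (hN.memLp _) (ht.monotone_meshExt i.le_succ)).integrableOn
  have i2 (i j l : ℕ) : IntegrableOn (fun ω ↦
      (N (refinedMesh t k (i * k + l + 1)) ω - N (refinedMesh t k (i * k + l)) ω) *
        (W (refinedMesh t k (i * k + j + 1)) ω - W (refinedMesh t k (i * k + j)) ω))
        (info N W t ⁻¹' B) P :=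
    (integrable_mul_increment hW (hN.memLp_increment (hmono (Nat.le_succ _)))
      (hmono (Nat.le_succ _))).integrableOn
  have i3 (i j : ℕ) := integrable_finsetSum (Finset.range j) fun l _ ↦ i2 i j l
  have i4 (i : ℕ) := integrable_finsetSum (Finset.range k) fun j _ ↦ i3 i j
  simp only [ht.riemannSum_refinedMesh hk]
  refine (integral_finsetSum _ fun i _ ↦ (i1 i).add (i4 i)).trans ?_
  refine Finset.sum_congr rfl fun i hi ↦ ?_
  simp only [Pi.add_apply]
  rw [integral_add (i1 i) (i4 i), integral_finsetSum _ fun j _ ↦ i3 i j]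
  congr 1
  have inner (j : ℕ) (hj : j ∈ Finset.range k) := (integral_finsetSum (Finset.range j)
    fun l _ ↦ i2 i j l).trans (Finset.sum_congr rfl fun l hl ↦
      setIntegral_refined_increments hW hN ht hB (Finset.mem_range.1 hi)
        ((Finset.mem_range.1 hl).trans (Finset.mem_range.1 hj)) (Finset.mem_range.1 hj))
  rw [Finset.sum_congr rfl inner]
  simp only [Finset.sum_const, Finset.card_range, nsmul_eq_mul]
  rw [← Finset.sum_mul, ← Nat.cast_sum]
  have gauss : ((∑ j ∈ Finset.range k, j : ℕ) : ℝ) = k * (k - 1) / 2 := by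
    have h : ((∑ j ∈ Finset.range k, j : ℕ) : ℝ) * 2 = k * ((k - 1 : ℕ) : ℝ) := by
      exact_mod_cast Finset.sum_range_id_mul_two k
    rw [Nat.cast_sub hk, Nat.cast_one] at h
    linarith
  rw [gauss]
  have : (k : ℝ) ≠ 0 := by positivity
  field_simp

lemma memLp_two_mul_increment (hW : IsWiener 𝓕 P W) (hN : IsPoisson 𝓕 P lam N) {a b : ℝ≥0}
    (hab : a ≤ b) :
    MemLp (fun ω ↦ (N b ω - N a ω) * (W b ω - W a ω)) 2 P := by
  -- A grid whose only increment in use is the one over `(a, b]`, so that the independence of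
  -- increment vectors applies.
  let s : ℕ → ℝ≥0 := fun p ↦ if p = 0 then a else b
  have hs : Monotone s := monotone_nat_of_le_succ fun p ↦ by
    rcases p with - | p <;> simp [s, hab]
  have h := (indepFun_increments hW hN hs 1).comp (measurable_pi_apply (0 : Fin 1))
    (measurable_pi_apply (0 : Fin 1))
  exact memLp_two_mul_of_indepFun h (hN.memLp_increment hab) (hW.memLp_increment hab (by simp))

lemma memLp_trapezoidal (hW : IsWiener 𝓕 P W) (hN : IsPoisson 𝓕 P lam N) (ht : IsMesh T n t) :
    MemLp (trapezoidal N W t) 2 P := by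
  have : trapezoidal N W t = fun ω ↦ ∑ i ∈ Finset.range n,
      (N (meshExt t i) ω * (W (meshExt t (i + 1)) ω - W (meshExt t i) ω) +
      1 / 2 * ((N (meshExt t (i + 1)) ω - N (meshExt t i) ω) *
        (W (meshExt t (i + 1)) ω - W (meshExt t i) ω))) := funext fun ω ↦ trapezoidal_eq t ω
  rw [this]
  refine memLp_finsetSum _ fun i _ ↦ ?_
  have hi := ht.monotone_meshExt i.le_succ
  exact (hW.memLp_mul_increment hi (hN.adapted _) (hN.memLp _)).add
    ((memLp_two_mul_increment hW hN hi).const_mul _)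

/-- The Riemann sums over the refined meshes converge to `J` in `L²`, hence in `L¹`, so their
integrals over the event converge; the weight of the mixed moments tends to `1 / 2`. -/
lemma setIntegral_eq_setIntegral_trapezoidal (hW : IsWiener 𝓕 P W) (hN : IsPoisson 𝓕 P lam N)
    {J : Ω → ℝ} (hJ : IsItoIntegral 𝓕 P W T N J) (ht : IsMesh T n t)
    {B : Set ((Fin n → ℝ) × (Fin n → ℝ))} (hB : MeasurableSet B) :
    ∫ ω in info N W t ⁻¹' B, J ω ∂P = ∫ ω in info N W t ⁻¹' B, trapezoidal N W t ω ∂P := by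
  have hgrid (k : ℕ) := ht.isGrid_refinedMesh (Nat.succ_pos k)
  have hR (k : ℕ) := (memLp_of_mem_itoPairs hW
    (gridPair_mem_itoPairs (W := W) hN (hgrid k))).2
  have h0 : Tendsto (fun k : ℕ ↦ (T : ℝ) / ((k + 1 : ℕ) : ℝ)) atTop (𝓝 0) :=
    (tendsto_const_div_atTop_nhds_zero_nat (T : ℝ)).comp (tendsto_add_atTop_nat 1)
  have lim2 : Tendsto (fun k : ℕ ↦ eLpNorm (fun ω ↦ J ω -
      riemannSum N W (refinedMesh t (k + 1)) (n * (k + 1)) ω) 2 P ^ 2) atTop (𝓝 0) := by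
    have h1 : Tendsto (fun k : ℕ ↦ ENNReal.ofReal (lam * ((T : ℝ) / ((k + 1 : ℕ) : ℝ)) +
        (lam * ((T : ℝ) / ((k + 1 : ℕ) : ℝ))) ^ 2) * T) atTop (𝓝 0) := by
      have h := ENNReal.tendsto_ofReal ((h0.const_mul (lam : ℝ)).add
        ((h0.const_mul (lam : ℝ)).pow 2))
      have h2 := ENNReal.Tendsto.mul_const h (b := (T : ℝ≥0∞)) (Or.inr (by simp))
      simpa using h2
    exact tendsto_of_tendsto_of_tendsto_of_le_of_le tendsto_const_nhds h1 (fun _ ↦ zero_le)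
      fun k ↦ hJ.eLpNorm_sub_riemannSum_sq_le hW hN (hgrid k)
  have lim1 : Tendsto (fun k : ℕ ↦ eLpNorm (fun ω ↦ J ω -
      riemannSum N W (refinedMesh t (k + 1)) (n * (k + 1)) ω) 2 P) atTop (𝓝 0) := by
    have := (ENNReal.continuous_rpow_const (y := (1 / 2 : ℝ))).tendsto 0 |>.comp lim2
    simp only [Function.comp_def, ← ENNReal.rpow_natCast, ← ENNReal.rpow_mul] at this
    simpa using this
  have limJ : Tendsto (fun k : ℕ ↦ ∫ ω in info N W t ⁻¹' B,
      riemannSum N W (refinedMesh t (k + 1)) (n * (k + 1)) ω ∂P) atTop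
      (𝓝 (∫ ω in info N W t ⁻¹' B, J ω ∂P)) := by
    refine tendsto_setIntegral_of_L1' J hJ.2.1.1
      (.of_forall fun k ↦ (hR k).integrable one_le_two) ?_ _
    refine tendsto_of_tendsto_of_tendsto_of_le_of_le tendsto_const_nhds lim1 (fun _ ↦ zero_le)
      fun k ↦ ?_
    rw [eLpNorm_sub_comm]
    exact eLpNorm_le_eLpNorm_of_exponent_le one_le_two (hJ.2.1.1.sub (hR k).1)
  refine tendsto_nhds_unique limJ ?_
  rw [setIntegral_trapezoidal hW hN ht]
  simp only [fun k : ℕ ↦ setIntegral_riemannSum hW hN ht (Nat.succ_pos k) hB]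
  refine tendsto_finsetSum _ fun i _ ↦ Tendsto.const_add _ (Tendsto.mul_const _ ?_)
  have h := ((tendsto_const_div_atTop_nhds_zero_nat (1 : ℝ)).comp
    (tendsto_add_atTop_nat 1)).const_mul (1 / 2 : ℝ) |>.const_sub (1 / 2 : ℝ)
  simpa using h

/-- The trapezoidal method is the conditional expectation of the Itô integral given the values at
the nodes. -/
theorem condExp_ae_eq_trapezoidal (hW : IsWiener 𝓕 P W) (hN : IsPoisson 𝓕 P lam N)
    {J : Ω → ℝ} (hJ : IsItoIntegral 𝓕 P W T N J) (ht : IsMesh T n t) :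
    P[J | MeasurableSpace.comap (info N W t) inferInstance] =ᵐ[P] trapezoidal N W t := by
  have hm := (measurable_info hW hN t).comap_le
  refine (ae_eq_condExp_of_forall_setIntegral_eq hm (hJ.2.1.integrable one_le_two)
    (fun S _ _ ↦ ((memLp_trapezoidal hW hN ht).integrable one_le_two).integrableOn)
    (fun S hS _ ↦ ?_) ?_).symm
  · obtain ⟨B, hB, rfl⟩ := hS
    exact (setIntegral_eq_setIntegral_trapezoidal hW hN hJ ht hB).symm
  · refine ⟨fun ω ↦ trapezoidalFun (info N W t ω), ?_, trapezoidal_ae_eq hW hN ht⟩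
    exact (measurable_trapezoidalFun.comp (comap_measurable _)).stronglyMeasurable

end CondExp

/-! ### The error of the trapezoidal method -/

lemma integral_sub_sq {P : Measure Ω} {X Y : Ω → ℝ} (hX : MemLp X 2 P) (hY : MemLp Y 2 P) :
    ∫ ω, (X ω - Y ω) ^ 2 ∂P = ∫ ω, X ω ^ 2 ∂P - 2 * ∫ ω, X ω * Y ω ∂P + ∫ ω, Y ω ^ 2 ∂P := by
  have i : Integrable (fun ω ↦ X ω * Y ω) P := hX.integrable_mul hY
  have i2 : Integrable (fun ω ↦ X ω ^ 2 - 2 * (X ω * Y ω)) P :=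
    hX.integrable_sq.sub (i.const_mul 2)
  rw [← integral_const_mul, ← integral_sub hX.integrable_sq (i.const_mul 2),
    ← integral_add i2 hY.integrable_sq]
  congr with ω
  ring

/-- Replacing a factor by its conditional expectation does not change the mixed moment with a
measurable factor. -/
lemma integral_mul_eq_of_condExp_ae_eq {P : Measure Ω} [IsFiniteMeasure P] {m : MeasurableSpace Ω}
    (hm : m ≤ mΩ) {J A C : Ω → ℝ} (hJ : MemLp J 2 P) (hA : P[J | m] =ᵐ[P] A)
    (hC : MemLp C 2 P) (hCm : AEStronglyMeasurable[m] C P) :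
    ∫ ω, J ω * C ω ∂P = ∫ ω, A ω * C ω ∂P := by
  have h := condExp_mul_of_aestronglyMeasurable_right hCm (hJ.integrable_mul hC)
    (hJ.integrable one_le_two)
  have e1 : ∫ ω, J ω * C ω ∂P = ∫ ω, (J * C) ω ∂P := rfl
  rw [e1, ← integral_condExp hm]
  refine integral_congr_ae ?_
  filter_upwards [h, hA] with ω h1 h2
  rw [h1, Pi.mul_apply, h2]

section Error

variable {P : Measure Ω} [IsFiniteMeasure P] {m : MeasurableSpace Ω} {J A C : Ω → ℝ}

/-- Pythagoras: the conditional expectation is an orthogonal projection, so the mean of `J A` equals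
that of `A ^ 2`. -/
lemma integral_sub_sq_of_condExp (hm : m ≤ mΩ) (hJ : MemLp J 2 P) (hA : P[J | m] =ᵐ[P] A)
    (hA2 : MemLp A 2 P) :
    ∫ ω, (J ω - A ω) ^ 2 ∂P = ∫ ω, J ω ^ 2 ∂P - ∫ ω, A ω ^ 2 ∂P := by
  have hAm : AEStronglyMeasurable[m] A P :=
    ⟨_, stronglyMeasurable_condExp, hA.symm⟩
  rw [integral_sub_sq hJ hA2, integral_mul_eq_of_condExp_ae_eq hm hJ hA hA2 hAm]
  simp only [← sq]
  ring

/-- The conditional expectation is the best approximation in `L²`. -/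
lemma eLpNorm_sub_condExp_le (hm : m ≤ mΩ) (hJ : MemLp J 2 P) (hA : P[J | m] =ᵐ[P] A)
    (hA2 : MemLp A 2 P) (hC : Measurable[m] C) :
    eLpNorm (fun ω ↦ J ω - A ω) 2 P ≤ eLpNorm (fun ω ↦ J ω - C ω) 2 P := by
  have hCm : AEStronglyMeasurable[mΩ] C P := (hC.mono hm le_rfl).aestronglyMeasurable
  -- `C` is not assumed square integrable. Either its error is infinite, or `C = J - (J - C)` lies
  -- in `L²`.
  by_cases htop : eLpNorm (fun ω ↦ J ω - C ω) 2 P = ∞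
  · rw [htop]; exact le_top
  have hJC : MemLp (fun ω ↦ J ω - C ω) 2 P := ⟨hJ.1.sub hCm, lt_top_iff_ne_top.2 htop⟩
  have hC2 : MemLp C 2 P := by
    refine (hJ.sub hJC).ae_eq (ae_of_all _ fun ω ↦ ?_)
    simp
  have hJA : MemLp (fun ω ↦ J ω - A ω) 2 P := hJ.sub hA2
  rw [eLpNorm_two_eq hJA, eLpNorm_two_eq hJC]
  refine ENNReal.ofReal_le_ofReal (Real.sqrt_le_sqrt ?_)
  have h := integral_nonneg (μ := P) (f := fun ω ↦ (A ω - C ω) ^ 2) fun ω ↦ sq_nonneg _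
  rw [integral_sub_sq hA2 hC2] at h
  rw [integral_sub_sq_of_condExp hm hJ hA hA2, integral_sub_sq hJ hC2,
    integral_mul_eq_of_condExp_ae_eq hm hJ hA hC2 hC.stronglyMeasurable.aestronglyMeasurable]
  linarith

end Error

section Trapezoidal

variable {𝓕 : Filtration ℝ≥0 mΩ} {P : Measure Ω} {W N : ℝ≥0 → Ω → ℝ} {T lam : ℝ≥0} {n : ℕ}
  {t : Fin (n + 1) → ℝ≥0}

lemma IsWiener.integral_increment_mul_increment (hW : IsWiener 𝓕 P W) {s : ℕ → ℝ≥0}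
    (hs : Monotone s) (i j : ℕ) :
    ∫ ω, (W (s (i + 1)) ω - W (s i) ω) * (W (s (j + 1)) ω - W (s j) ω) ∂P =
      if i = j then (s (i + 1) : ℝ) - s i else 0 := by
  have lt {i j : ℕ} (h : i < j) :
      ∫ ω, (W (s (i + 1)) ω - W (s i) ω) * (W (s (j + 1)) ω - W (s j) ω) ∂P = 0 :=
    hW.integral_mul_increment (G := fun ω ↦ W (s (i + 1)) ω - W (s i) ω) (hs j.le_succ)
      (((hW.adapted _).mono (𝓕.mono (hs h)) le_rfl).sub
        ((hW.adapted _).mono (𝓕.mono (hs h.le)) le_rfl))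
  split_ifs with h
  · subst h
    rw [← hW.integral_increment_sq (hs i.le_succ)]
    simp only [sq]
  · rcases lt_or_gt_of_ne h with h | h
    · exact lt h
    · simp only [mul_comm (W (s (i + 1)) _ - _)]
      exact lt h

/-- Write the sum as `2 N a` plus the increment over `(a, b]`, which is independent of `N a`. -/
lemma IsPoisson.integral_add_sq (hN : IsPoisson 𝓕 P lam N) {a b : ℝ≥0} (hab : a ≤ b) :
    ∫ ω, (N a ω + N b ω) ^ 2 ∂P = 4 * (lam * a + (lam * a) ^ 2) +
      4 * (lam * a) * (lam * (b - a)) + (lam * (b - a) + (lam * (b - a)) ^ 2) := by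
  have l1 := hN.memLp a
  have l2 := hN.memLp_increment hab
  have hi := (hN.indepFun_increment hab (hN.adapted a)).integral_fun_mul_eq_mul_integral
    l1.1 l2.1
  rw [hN.integral, hN.integral_increment hab] at hi
  have i2 : Integrable (fun ω ↦ 4 * (N a ω * (N b ω - N a ω))) P :=
    (l1.integrable_mul l2).const_mul 4
  have i1 : Integrable (fun ω ↦ 4 * N a ω ^ 2) P := l1.integrable_sq.const_mul 4
  have i3 : Integrable (fun ω ↦ 4 * N a ω ^ 2 + 4 * (N a ω * (N b ω - N a ω))) P := i1.add i2
  calc _ = ∫ ω, (4 * N a ω ^ 2 + 4 * (N a ω * (N b ω - N a ω)) + (N b ω - N a ω) ^ 2) ∂P := by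
        congr with ω; ring
    _ = _ := by
        rw [integral_add i3 l2.integrable_sq, integral_add i1 i2, integral_const_mul,
          integral_const_mul, hi, hN.integral_sq, hN.integral_increment_sq hab]
        ring

/-- The sum of the first `i` coordinates. -/
def partialSum {n : ℕ} (x : Fin n → ℝ) (i : ℕ) : ℝ :=
  ∑ p : Fin n, if (p : ℕ) < i then x p else 0

lemma measurable_partialSum {n : ℕ} (i : ℕ) : Measurable fun x : Fin n → ℝ ↦ partialSum x i :=
  Finset.measurable_sum _ fun p _ ↦ by split_ifs <;> fun_prop

lemma partialSum_increments {X : ℝ≥0 → Ω → ℝ} {s : ℕ → ℝ≥0} {ω : Ω} (h0 : X (s 0) ω = 0) {i : ℕ}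
    (hi : i ≤ n) : partialSum (increments X s n ω) i = X (s i) ω := by
  have e : (Finset.range n).filter (fun p ↦ p < i) = Finset.range i := by
    ext p
    simp only [Finset.mem_filter, Finset.mem_range]
    omega
  unfold partialSum increments
  rw [Finset.sum_fin_eq_sum_range]
  calc _ = ∑ p ∈ Finset.range n, if p < i then X (s (p + 1)) ω - X (s p) ω else 0 :=
        Finset.sum_congr rfl fun p hp ↦ by rw [dif_pos (Finset.mem_range.1 hp)]
    _ = ∑ p ∈ Finset.range i, (X (s (p + 1)) ω - X (s p) ω) := by rw [← Finset.sum_filter, e]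
    _ = _ := by rw [Finset.sum_range_sub fun p ↦ X (s p) ω, h0, sub_zero]

variable [IsProbabilityMeasure P]

/-- The second moment of a sum of products of increments of `W` with factors depending on `N`. -/
lemma integral_sq_sum_increment_mul (hW : IsWiener 𝓕 P W) (hN : IsPoisson 𝓕 P lam N)
    {s : ℕ → ℝ≥0} (hs : Monotone s) {ψ : Fin n → (Fin n → ℝ) → ℝ} (hψ : ∀ i, Measurable (ψ i))
    (hψ2 : ∀ i, MemLp (fun ω ↦ ψ i (increments N s n ω)) 2 P) :
    ∫ ω, (∑ i, increments W s n ω i * ψ i (increments N s n ω)) ^ 2 ∂P =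
      ∑ i : Fin n, ((s (i + 1) : ℝ) - s i) * ∫ ω, ψ i (increments N s n ω) ^ 2 ∂P := by
  set X := increments N s n
  set Y := increments W s n
  have hind : IndepFun X Y P := indepFun_increments hW hN hs n
  have hX : Measurable X := measurable_increments hN.measurable s n
  have hY : Measurable Y := measurable_increments hW.measurable s n
  have hY2 (i : Fin n) : MemLp (fun ω ↦ Y ω i) 2 P :=
    hW.memLp_increment (hs (Nat.le_succ _)) (by simp)
  have l (i : Fin n) : MemLp (fun ω ↦ Y ω i * ψ i (X ω)) 2 P :=
    memLp_two_mul_of_indepFun (hind.symm.comp (measurable_pi_apply i) (hψ i)) (hY2 i) (hψ2 i)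
  have i1 (i j : Fin n) : Integrable (fun ω ↦ Y ω i * ψ i (X ω) * (Y ω j * ψ j (X ω))) P :=
    (l i).integrable_mul (l j)
  have e (i j : Fin n) : ∫ ω, Y ω i * ψ i (X ω) * (Y ω j * ψ j (X ω)) ∂P =
      if i = j then ((s (i + 1) : ℝ) - s i) * ∫ ω, ψ i (X ω) ^ 2 ∂P else 0 := by
    -- Independence of the two increment vectors separates the `W` part from the `N` part, and the
    -- `W` part vanishes off the diagonal.
    have h := hind.symm.integral_fun_comp_mul_comp (f := fun y ↦ y i * y j)
      (g := fun x ↦ ψ i x * ψ j x) hY.aemeasurable hX.aemeasurable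
      (Measurable.aestronglyMeasurable (by fun_prop))
      ((hψ i).mul (hψ j)).aestronglyMeasurable
    have h2 : ∫ ω, Y ω i * Y ω j ∂P = _ := hW.integral_increment_mul_increment hs i j
    rw [h2] at h
    calc _ = ∫ ω, Y ω i * Y ω j * (ψ i (X ω) * ψ j (X ω)) ∂P := by congr with ω; ring
      _ = _ := by
        rw [h]
        simp only [Fin.val_inj]
        split_ifs with hij
        · subst hij; simp only [sq]
        · rw [zero_mul]
  simp only [sq (∑ i, _), Finset.sum_mul_sum]
  rw [integral_finsetSum _ fun i _ ↦ integrable_finsetSum _ fun j _ ↦ i1 i j]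
  refine Finset.sum_congr rfl fun i _ ↦ ?_
  rw [integral_finsetSum _ fun j _ ↦ i1 i j]
  simp only [e, Finset.sum_ite_eq, Finset.mem_univ, if_true]

lemma integral_trapezoidal_sq (hW : IsWiener 𝓕 P W) (hN : IsPoisson 𝓕 P lam N)
    (ht : IsMesh T n t) :
    ∫ ω, trapezoidal N W t ω ^ 2 ∂P = ∑ i ∈ Finset.range n,
      ((meshExt t (i + 1) : ℝ) - meshExt t i) *
        (1 / 4 * ∫ ω, (N (meshExt t i) ω + N (meshExt t (i + 1)) ω) ^ 2 ∂P) := by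
  set s := meshExt t with hs
  have hmono : Monotone s := ht.monotone_meshExt
  -- The half-sum of the node values of `N`, written as a function of its increments alone.
  let ψ : Fin n → (Fin n → ℝ) → ℝ := fun i x ↦ 1 / 2 * (partialSum x i + partialSum x (i + 1))
  have hψ (i : Fin n) : Measurable (ψ i) :=
    ((measurable_partialSum _).add (measurable_partialSum _)).const_mul _
  have hψe : ∀ᵐ ω ∂P, ∀ i, ψ i (increments N s n ω) = 1 / 2 * (N (s i) ω + N (s (i + 1)) ω) := by
    filter_upwards [hN.zero] with ω h0 i
    have h0' : N (s 0) ω = 0 := by rw [hs, ht.meshExt_zero, h0]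
    simp only [ψ]
    rw [partialSum_increments h0' i.2.le, partialSum_increments h0' i.2]
  have hψ2 (i : Fin n) : MemLp (fun ω ↦ ψ i (increments N s n ω)) 2 P := by
    refine (((hN.memLp (s i)).add (hN.memLp (s (i + 1)))).const_mul (1 / 2)).ae_eq ?_
    filter_upwards [hψe] with ω h
    rw [h]
    rfl
  have key := integral_sq_sum_increment_mul hW hN hmono hψ hψ2
  rw [Finset.sum_range]
  calc _ = ∫ ω, (∑ i, increments W s n ω i * ψ i (increments N s n ω)) ^ 2 ∂P := by
        refine integral_congr_ae ?_
        filter_upwards [hψe] with ω h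
        simp only [h]
        congr 1
        refine Finset.sum_congr rfl fun i _ ↦ ?_
        rw [hs, meshExt_castSucc, meshExt_succ, increments, meshExt_castSucc, meshExt_succ]
        ring
    _ = _ := by
        rw [key]
        refine Finset.sum_congr rfl fun i _ ↦ ?_
        congr 1
        rw [← integral_const_mul]
        refine integral_congr_ae ?_
        filter_upwards [hψe] with ω h
        rw [h]
        ring

/-- The squared error of the trapezoidal method. -/
noncomputable def squaredError (lam : ℝ≥0) {n : ℕ} (t : Fin (n + 1) → ℝ≥0) : ℝ :=
  ∑ i ∈ Finset.range n, (lam / 4 * ((meshExt t (i + 1) : ℝ) - meshExt t i) ^ 2 +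
    lam ^ 2 / 12 * ((meshExt t (i + 1) : ℝ) - meshExt t i) ^ 3)

theorem integral_sub_trapezoidal_sq (hW : IsWiener 𝓕 P W) (hN : IsPoisson 𝓕 P lam N)
    {J : Ω → ℝ} (hJ : IsItoIntegral 𝓕 P W T N J) (ht : IsMesh T n t) :
    ∫ ω, (J ω - trapezoidal N W t ω) ^ 2 ∂P = squaredError lam t := by
  rw [integral_sub_sq_of_condExp (measurable_info hW hN t).comap_le hJ.2.1
    (condExp_ae_eq_trapezoidal hW hN hJ ht) (memLp_trapezoidal hW hN ht), hJ.integral_sq hW hN,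
    integral_trapezoidal_sq hW hN ht]
  -- The second moment of `J` is telescoped along the mesh, so that the two moments can be
  -- subtracted interval by interval.
  have tel := Finset.sum_range_sub (fun i ↦ (lam : ℝ) * (meshExt t i : ℝ) ^ 2 / 2 +
    lam ^ 2 * (meshExt t i : ℝ) ^ 3 / 3) n
  rw [ht.meshExt_last, ht.meshExt_zero] at tel
  simp only [NNReal.coe_zero, ne_eq, OfNat.ofNat_ne_zero, not_false_eq_true, zero_pow, mul_zero,
    zero_div, add_zero, sub_zero] at tel
  rw [← tel, ← Finset.sum_sub_distrib, squaredError]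
  refine Finset.sum_congr rfl fun i _ ↦ ?_
  rw [hN.integral_add_sq (ht.monotone_meshExt i.le_succ)]
  ring

theorem error_trapezoidal (hW : IsWiener 𝓕 P W) (hN : IsPoisson 𝓕 P lam N)
    {J : Ω → ℝ} (hJ : IsItoIntegral 𝓕 P W T N J) (ht : IsMesh T n t) :
    error P J (trapezoidal N W t) = ENNReal.ofReal √(squaredError lam t) := by
  have hm : MemLp (fun ω ↦ J ω - trapezoidal N W t ω) 2 P :=
    hJ.2.1.sub (memLp_trapezoidal hW hN ht)
  rw [error, eLpNorm_two_eq hm, integral_sub_trapezoidal_sq hW hN hJ ht]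

/-- No method that uses the values at the nodes of a mesh is better than the trapezoidal method. -/
lemma error_trapezoidal_le (hW : IsWiener 𝓕 P W) (hN : IsPoisson 𝓕 P lam N)
    {J : Ω → ℝ} (hJ : IsItoIntegral 𝓕 P W T N J) (ht : IsMesh T n t)
    {φ : (Fin n → ℝ) × (Fin n → ℝ) → ℝ} (hφ : Measurable φ) :
    error P J (trapezoidal N W t) ≤ error P J fun ω ↦ φ (info N W t ω) :=
  eLpNorm_sub_condExp_le (measurable_info hW hN t).comap_le hJ.2.1
    (condExp_ae_eq_trapezoidal hW hN hJ ht) (memLp_trapezoidal hW hN ht)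
    (hφ.comp (comap_measurable _))

end Trapezoidal

/-! ### The equidistant mesh -/

section Equidistant

variable {T lam : ℝ≥0} {n : ℕ} {t : Fin (n + 1) → ℝ≥0}

lemma isMesh_equidistant (hT : 0 < T) (hn : 1 ≤ n) : IsMesh T n (equidistant T n) where
  strictMono i j h := by
    have h' : ((i : ℕ) : ℝ≥0) < (j : ℕ) := by exact_mod_cast h
    have hn' : (0 : ℝ≥0) < n := by exact_mod_cast hn
    unfold equidistant
    gcongr
  first := by simp [equidistant]
  last := by
    have hn' : (n : ℝ≥0) ≠ 0 := by positivity
    simp only [equidistant, Fin.val_last]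
    field_simp

lemma squaredError_equidistant (hn : 1 ≤ n) : squaredError lam (equidistant T n) =
    lam * T ^ 2 / (4 * n) + lam ^ 2 * T ^ 3 / (12 * n ^ 2) := by
  have hn' : (n : ℝ) ≠ 0 := by positivity
  have gap : ∀ i ∈ Finset.range n, (meshExt (equidistant T n) (i + 1) : ℝ) -
      meshExt (equidistant T n) i = T / n := fun i hi ↦ by
    have h := Finset.mem_range.1 hi
    have h1 := meshExt_castSucc (equidistant T n) ⟨i, h⟩
    have h2 := meshExt_succ (equidistant T n) ⟨i, h⟩
    simp only at h1 h2
    rw [h1, h2]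
    simp only [equidistant, Fin.val_succ, Fin.val_castSucc]
    push_cast
    ring
  rw [squaredError, Finset.sum_congr rfl fun i hi ↦ by rw [gap i hi]]
  simp only [Finset.sum_const, Finset.card_range, nsmul_eq_mul]
  field_simp

/-- The gaps have the fixed sum `T`, and by convexity their sums of squares and of cubes are both
least when all gaps are equal. -/
lemma squaredError_equidistant_le (ht : IsMesh T n t) (hn : 1 ≤ n) :
    squaredError lam (equidistant T n) ≤ squaredError lam t := by
  have hn' : (0 : ℝ) < n := by exact_mod_cast hn
  have hnn : ∀ i ∈ Finset.range n, 0 ≤ (meshExt t (i + 1) : ℝ) - meshExt t i := fun i _ ↦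
    sub_nonneg.2 (by exact_mod_cast ht.monotone_meshExt i.le_succ)
  have tel : ∑ i ∈ Finset.range n, ((meshExt t (i + 1) : ℝ) - meshExt t i) = T := by
    rw [Finset.sum_range_sub fun i ↦ (meshExt t i : ℝ), ht.meshExt_last, ht.meshExt_zero]
    simp
  -- The exponent in this inequality is the argument plus one: squares here, cubes next.
  have h2 := pow_sum_div_card_le_sum_pow hnn 1
  have h3 := pow_sum_div_card_le_sum_pow hnn 2
  rw [tel, Finset.card_range] at h2 h3
  rw [squaredError_equidistant hn, squaredError, Finset.sum_add_distrib, ← Finset.mul_sum,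
    ← Finset.mul_sum]
  calc _ = (lam : ℝ) / 4 * (T ^ (1 + 1) / n ^ 1) + lam ^ 2 / 12 * (T ^ (2 + 1) / n ^ 2) := by
        field_simp
        ring
    _ ≤ _ := by gcongr

/-- Multiplied by `n`, the squared error is `lam T² / 4` plus a term of order `1 / n`. -/
lemma tendsto_error_equidistant : Tendsto (fun n : ℕ ↦ (n : ℝ≥0∞) ^ (1 / 2 : ℝ) *
      ENNReal.ofReal √(lam * T ^ 2 / (4 * n) + lam ^ 2 * T ^ 3 / (12 * n ^ 2))) atTop
    (𝓝 (ENNReal.ofReal ((lam : ℝ) ^ (1 / 2 : ℝ) * T / 2))) := by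
  have h0 := tendsto_const_div_atTop_nhds_zero_nat ((lam : ℝ) ^ 2 * T ^ 3 / 12)
  have h1 := (Real.continuous_sqrt.tendsto _).comp (h0.const_add ((lam : ℝ) * T ^ 2 / 4))
  have e : √((lam : ℝ) * T ^ 2 / 4 + 0) = (lam : ℝ) ^ (1 / 2 : ℝ) * T / 2 := by
    rw [add_zero, ← Real.sqrt_eq_rpow, show (lam : ℝ) * T ^ 2 / 4 = lam * (T / 2) ^ 2 by ring,
      Real.sqrt_mul lam.coe_nonneg, Real.sqrt_sq (by positivity)]
    ring
  rw [e] at h1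
  refine (ENNReal.tendsto_ofReal h1).congr' ?_
  filter_upwards [eventually_ge_atTop 1] with n hn
  have hn' : (n : ℝ) ≠ 0 := by positivity
  have hc : (n : ℝ≥0∞) ^ (1 / 2 : ℝ) = ENNReal.ofReal √n := by
    rw [Real.sqrt_eq_rpow, ← ENNReal.ofReal_rpow_of_nonneg (by positivity) (by norm_num),
      ENNReal.ofReal_natCast]
  rw [hc, ← ENNReal.ofReal_mul (Real.sqrt_nonneg _), ← Real.sqrt_mul (by positivity),
    Function.comp_apply]
  congr 2
  field_simp

end Equidistant

/-- A method on any mesh is no better than the trapezoidal method on that mesh, which is no better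
than the one on the equidistant mesh. -/
theorem error_equidistant_eq_minimalError {𝓕 : Filtration ℝ≥0 mΩ} {P : Measure Ω}
    [IsProbabilityMeasure P] {W N : ℝ≥0 → Ω → ℝ} {T lam : ℝ≥0} {n : ℕ} (hT : 0 < T)
    (hW : IsWiener 𝓕 P W) (hN : IsPoisson 𝓕 P lam N) {J : Ω → ℝ}
    (hJ : IsItoIntegral 𝓕 P W T N J) (hn : 1 ≤ n) :
    error P J (trapezoidal N W (equidistant T n)) = minimalError P N W T J n := by
  have he := isMesh_equidistant hT hn
  apply le_antisymm
  · refine le_iInf₂ fun A hA ↦ ?_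
    obtain ⟨t, ht, φ, hφ, rfl⟩ := hA
    refine le_trans ?_ (error_trapezoidal_le hW hN hJ ht hφ)
    rw [error_trapezoidal hW hN hJ he, error_trapezoidal hW hN hJ ht]
    exact ENNReal.ofReal_le_ofReal (Real.sqrt_le_sqrt (squaredError_equidistant_le ht hn))
  -- The trapezoidal sum reads the values at time `0`, so the admissible method used is its version
  -- with zeros in their place, which has the same error.
  · refine (iInf₂_le (fun ω ↦ trapezoidalFun (info N W (equidistant T n) ω))
      ⟨_, he, _, measurable_trapezoidalFun, rfl⟩).trans (le_of_eq ?_)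
    refine eLpNorm_congr_ae ?_
    filter_upwards [trapezoidal_ae_eq hW hN he] with ω hω
    rw [hω]

end LevyArea

theorem theorem4p2 {Ω : Type*} {mΩ : MeasurableSpace Ω} (P : Measure Ω) [IsProbabilityMeasure P]
    (𝓕 : Filtration ℝ≥0 mΩ) (W N : ℝ≥0 → Ω → ℝ) (lam T : ℝ≥0) (hlam : 0 < lam) (hT : 0 < T)
    (hW : LevyArea.IsWiener 𝓕 P W) (hN : LevyArea.IsPoisson 𝓕 P lam N) :
    -- the Lévy area `∫_0^T N(t) dW(t)` exists
    (∃ J : Ω → ℝ, LevyArea.IsItoIntegral 𝓕 P W T N J) ∧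
    ∀ J : Ω → ℝ, LevyArea.IsItoIntegral 𝓕 P W T N J →
      -- the trapezoidal method is the conditional expectation given the information
      (∀ (n : ℕ) (t : Fin (n + 1) → ℝ≥0), LevyArea.IsMesh T n t →
        P[J | MeasurableSpace.comap (LevyArea.info N W t) inferInstance]
          =ᵐ[P] LevyArea.trapezoidal N W t) ∧
      -- the error of the trapezoidal method on the equidistant mesh
      Tendsto (fun n : ℕ ↦ (n : ℝ≥0∞) ^ (1 / 2 : ℝ) *
          LevyArea.error P J (LevyArea.trapezoidal N W (LevyArea.equidistant T n)))
        atTop (𝓝 (ENNReal.ofReal ((lam : ℝ) ^ (1 / 2 : ℝ) * T / 2))) ∧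
      -- the minimal error
      Tendsto (fun n : ℕ ↦ (n : ℝ≥0∞) ^ (1 / 2 : ℝ) * LevyArea.minimalError P N W T J n)
        atTop (𝓝 (ENNReal.ofReal ((lam : ℝ) ^ (1 / 2 : ℝ) * T / 2))) ∧
      -- optimality of the trapezoidal method on the equidistant mesh
      ∀ n : ℕ, 1 ≤ n →
        LevyArea.error P J (LevyArea.trapezoidal N W (LevyArea.equidistant T n)) =
          LevyArea.minimalError P N W T J n := by
  refine ⟨LevyArea.IsPoisson.exists_isItoIntegral hW hN, fun J hJ ↦
    ⟨fun n t ht ↦ LevyArea.condExp_ae_eq_trapezoidal hW hN hJ ht, ?_, ?_, fun n hn ↦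
      LevyArea.error_equidistant_eq_minimalError hT hW hN hJ hn⟩⟩
  · refine (LevyArea.tendsto_error_equidistant (lam := lam) (T := T)).congr' ?_
    filter_upwards [eventually_ge_atTop 1] with n hn
    rw [LevyArea.error_trapezoidal hW hN hJ (LevyArea.isMesh_equidistant hT hn),
      LevyArea.squaredError_equidistant hn]
  · refine (LevyArea.tendsto_error_equidistant (lam := lam) (T := T)).congr' ?_
    filter_upwards [eventually_ge_atTop 1] with n hn
    rw [← LevyArea.error_equidistant_eq_minimalError hT hW hN hJ hn,
      LevyArea.error_trapezoidal hW hN hJ (LevyArea.isMesh_equidistant hT hn),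
      LevyArea.squaredError_equidistant hn]
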